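/- For $N\in\{5,7,9\}$ let $|D_N^{(\alpha)}\rangle$ ($\alpha=0,\dots,N$) be the normalized Dicke states of $N$ qubits ($\alpha$ qubits in state $|1\rangle$), an orthonormal basis of the symmetric subspace. Fix a sign $s\in\{1,-1\}$ and put $$|\mathrm{GHZ}_N\rangle=\tfrac1{\sqrt2}\big(|D_N^{(0)}\rangle+s\,|D_N^{(N)}\rangle\big),\qquad \rho_N(p)=\frac{p}{N+1}\sum_{\alpha=0}^N|D_N^{(\alpha)}\rangle\langle D_N^{(\alpha)}|+(1-p)\,|\mathrm{GHZ}_N\rangle\langle \mathrm{GHZ}_N|.$$ Let $W_N$ be the operator on the symmetric subspace (zero on its orthogonal complement) whose only non-zero entries in the Dicke basis are a diagonal, symmetric under $\alpha\mapsto N-\alpha$, and the two corner entries $\langle D_N^{(0)}|W_N|D_N^{(N)}\rangle=\langle D_N^{(N)}|W_N|D_N^{(0)}\rangle=s\,c_N$, where the first half of the diagonal and $c_N$ are - $N=5$: $(0.0366656,\,-0.134595,\,1)$, $c_5=-9.31947$; - $N=7$: $(0.00197514,\,0.0643064,\,-0.189017,\,1)$, $c_7=-31.2405$; - $N=9$: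 $(0.00235791,\,-0.013747,\,0.0621661,\,-0.1636915,\,1)$, $c_9=-114.305$. An $N$-qubit state is *separable* if it is a convex combination of projectors onto pure product states $|\varphi_1\rangle\otimes\cdots\otimes|\varphi_N\rangle$, and *entangled* otherwise; it is *PPT* if its partial transpose with respect to every set of qubits is positive semidefinite. A symmetric state $\rho$ (a density operator with $\pi\rho\pi'=\rho$ for all permutation operators $\pi,\pi'$ of the qubits) is *SAPPT* (respectively *SAS*) if $U\rho U^\dagger$ is PPT (respectively separable) for every $U\in\mathrm{SU}(N+1)$ acting on the symmetric subspace. Let $p_{\min}=\frac{30}{31},\frac{140}{141},\frac{630}{631}$ for $N=5,7,9$ respectively. Then for each $N\in\{5,7,9\}$: 1. $\langle\varphi^{\otimes N}|W_N|\varphi^{\otimes N}\rangle\ge 0$ for every unit vector $|\varphi\rangle\in\mathbb C^2$. 2. There is a number $p^{W_N}$, with $0.96862<p^{W_5}<0.96863$, $0.99302<p^{W_7}<0.99303$, $0.99845<p^{W_9}<0.99846$, such that for $p\in[0,1]$ one has $\mathrm{Tr}(\rho_N(p)W_N)<0$ if and only if $p<p^{W_N}$; moreover $\rho_N(p)$ is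 a symmetric state and is entangled for all $p\in[0,p^{W_N}]$. 3. For all $p\in[p_{\min},p^{W_N}]$ the state $\rho_N(p)$ is SAPPT and entangled, and hence not SAS. -/

import Mathlib

open scoped ComplexOrder

namespace SymQubit

/-- Vectors of the `N`-qubit space `(ℂ²)^{⊗N}`, by coordinates in the computational basis. -/
abbrev Ket (N : ℕ) := (Fin N → Fin 2) → ℂ

/-- Operators on the `N`-qubit space, as matrices in the computational basis. -/
abbrev Op (N : ℕ) := Matrix (Fin N → Fin 2) (Fin N → Fin 2) ℂ

/-- The rank-one operator `|ψ⟩⟨χ|`. -/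
def ketBra {N : ℕ} (ψ χ : Ket N) : Op N := Matrix.vecMulVec ψ (star χ)

/-- The expectation value `⟨ψ|W|ψ⟩`. -/
def expect {N : ℕ} (W : Op N) (ψ : Ket N) : ℂ := star ψ ⬝ᵥ W.mulVec ψ

/-- The product vector `φ₁ ⊗ ⋯ ⊗ φ_N`. -/
def productKet {N : ℕ} (φ : Fin N → Fin 2 → ℂ) : Ket N := fun x => ∏ i, φ i (x i)

/-- The normalized Dicke state with `α` qubits in the state `1`. -/
noncomputable def dicke (N : ℕ) (α : Fin (N + 1)) : Ket N := fun x =>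
  if (∑ i, (x i : ℕ)) = (α : ℕ) then (((Real.sqrt (N.choose α : ℝ))⁻¹ : ℝ) : ℂ) else 0

/-- The operator on the symmetric subspace with matrix `M` in the Dicke basis
(extended by zero on the orthogonal complement). -/
noncomputable def dickeOp (N : ℕ) (M : Matrix (Fin (N + 1)) (Fin (N + 1)) ℂ) : Op N :=
  ∑ α, ∑ β, M α β • ketBra (dicke N α) (dicke N β)

/-- The GHZ state with relative sign `s`, `(|D_N^(0)⟩ + s |D_N^(N)⟩)/√2`. -/
noncomputable def ghz (N : ℕ) (s : ℂ) : Ket N :=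
  (((Real.sqrt 2)⁻¹ : ℝ) : ℂ) • (dicke N 0 + s • dicke N (Fin.last N))

/-- The maximally mixed state of the symmetric subspace. -/
noncomputable def maxMixed (N : ℕ) : Op N :=
  ((N : ℂ) + 1)⁻¹ • ∑ α, ketBra (dicke N α) (dicke N α)

/-- `ρ(p) = p ρ₀ + (1 - p) |GHZ⟩⟨GHZ|`. -/
noncomputable def rho (N : ℕ) (s : ℂ) (p : ℝ) : Op N :=
  (p : ℂ) • maxMixed N + ((1 - p : ℝ) : ℂ) • ketBra (ghz N s) (ghz N s)

/-- The operator permuting the `N` qubits by `σ`. -/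
def permOp {N : ℕ} (σ : Equiv.Perm (Fin N)) : Op N :=
  Matrix.of fun x y => if x = y ∘ σ then 1 else 0

/-- Density operators `ρ` with `ρ = π ρ π'` for all permutation operators `π`, `π'`. -/
def IsSymmetricState {N : ℕ} (ρ : Op N) : Prop :=
  ρ.PosSemidef ∧ ρ.trace = 1 ∧ ∀ σ τ : Equiv.Perm (Fin N), permOp σ * ρ * permOp τ = ρ

/-- Full `N`-partite separability: a convex combination of projectors on pure product states. -/
def IsSeparable {N : ℕ} (ρ : Op N) : Prop :=
  ρ ∈ convexHull ℝ {P : Op N | ∃ φ : Fin N → Fin 2 → ℂ,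
    (∀ i, star (φ i) ⬝ᵥ φ i = 1) ∧ P = ketBra (productKet φ) (productKet φ)}

/-- A state is entangled when it is not separable. -/
def IsEntangled {N : ℕ} (ρ : Op N) : Prop := ¬ IsSeparable ρ

/-- The partial transpose with respect to the set `A` of qubits. -/
def partialTranspose {N : ℕ} (A : Finset (Fin N)) (ρ : Op N) : Op N :=
  Matrix.of fun x y =>
    ρ (fun i => if i ∈ A then y i else x i) (fun i => if i ∈ A then x i else y i)

/-- Positive partial transpose with respect to every bipartition of the qubits. -/
def IsPPT {N : ℕ} (ρ : Op N) : Prop :=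
  ∀ A : Finset (Fin N), (partialTranspose A ρ).PosSemidef

/-- `U ρ U†` where `U` acts on the symmetric subspace by the matrix `u` in the Dicke basis. -/
noncomputable def symConj {N : ℕ} (u : Matrix (Fin (N + 1)) (Fin (N + 1)) ℂ) (ρ : Op N) : Op N :=
  dickeOp N u * ρ * (dickeOp N u).conjTranspose

/-- Symmetric absolutely PPT. -/
def IsSAPPT {N : ℕ} (ρ : Op N) : Prop :=
  IsSymmetricState ρ ∧
    ∀ u ∈ Matrix.specialUnitaryGroup (Fin (N + 1)) ℂ, IsPPT (symConj u ρ)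

/-- Symmetric absolutely separable. -/
def IsSAS {N : ℕ} (ρ : Op N) : Prop :=
  IsSymmetricState ρ ∧
    ∀ u ∈ Matrix.specialUnitaryGroup (Fin (N + 1)) ℂ, IsSeparable (symConj u ρ)

/-- The witness for five qubits; the sign of its corner entries goes with that of the GHZ state. -/
noncomputable def W5 (s : ℂ) : Op 5 :=
  let a : ℂ := 0.0366656
  let b : ℂ := -0.134595
  let c : ℂ := s * (-9.31947)
  dickeOp 5 !![a, 0, 0, 0, 0, c;
               0, b, 0, 0, 0, 0;
               0, 0, 1, 0, 0, 0;
               0, 0, 0, 1, 0, 0;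
               0, 0, 0, 0, b, 0;
               c, 0, 0, 0, 0, a]

/-- The witness for seven qubits. -/
noncomputable def W7 (s : ℂ) : Op 7 :=
  let a : ℂ := 0.00197514
  let b : ℂ := 0.0643064
  let c : ℂ := -0.189017
  let d : ℂ := s * (-31.2405)
  dickeOp 7 !![a, 0, 0, 0, 0, 0, 0, d;
               0, b, 0, 0, 0, 0, 0, 0;
               0, 0, c, 0, 0, 0, 0, 0;
               0, 0, 0, 1, 0, 0, 0, 0;
               0, 0, 0, 0, 1, 0, 0, 0;
               0, 0, 0, 0, 0, c, 0, 0;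
               0, 0, 0, 0, 0, 0, b, 0;
               d, 0, 0, 0, 0, 0, 0, a]

/-- The witness for nine qubits. -/
noncomputable def W9 (s : ℂ) : Op 9 :=
  let a : ℂ := 0.00235791
  let b : ℂ := -0.013747
  let c : ℂ := 0.0621661
  let d : ℂ := -0.1636915
  let e : ℂ := s * (-114.305)
  dickeOp 9 !![a, 0, 0, 0, 0, 0, 0, 0, 0, e;
               0, b, 0, 0, 0, 0, 0, 0, 0, 0;
               0, 0, c, 0, 0, 0, 0, 0, 0, 0;
               0, 0, 0, d, 0, 0, 0, 0, 0, 0;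
               0, 0, 0, 0, 1, 0, 0, 0, 0, 0;
               0, 0, 0, 0, 0, 1, 0, 0, 0, 0;
               0, 0, 0, 0, 0, 0, d, 0, 0, 0;
               0, 0, 0, 0, 0, 0, 0, c, 0, 0;
               0, 0, 0, 0, 0, 0, 0, 0, b, 0;
               e, 0, 0, 0, 0, 0, 0, 0, 0, a]

end SymQubit

open scoped ComplexOrder
namespace SymQubit
open Matrix

/-! In Dicke coordinates, `M ↦ dickeOp N M` is a trace-preserving *-homomorphism. Conjugating `rho N
s p` by a unitary of the symmetric subspace fixes the maximally mixed part and only moves the GHZ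
vector to another unit vector. SAPPT therefore asks that `p/(N+1) · P + (1-p)|ψ⟩⟨ψ|` be PPT for
every symmetric unit vector `ψ`, where `P` is the symmetric projector.

For a cut into `q` and `r` qubits, let `Q` be the tensor product of the two local symmetric
projectors. The PPT bound combines two operator inequalities. The partial transpose of `P` is at
least `Q / C(N,q)`: averaging permutations by the number `h` of qubits they exchange across the cut
writes `C(N,q) · P` as a sum over `h`, in which the partial transpose turns each exchange into a
positive contraction, and the term `h = 0` is `Q` (`sum_contraction`,
`posSemidef_symProj_sub_weightDiag`). The partial transpose of `|ψ⟩⟨ψ|` is at least `-Q / 2`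
(`posSemidef_partialTranspose_pure_add`, `posSemidef_pure_add_weightDiag`). So `(1-p)/2 · C(N,q) ≤
p/(N+1)` suffices, and the middle binomial is the worst case; equality there gives the stated
`p_min` (`isPPT_dickeOp_mixMatrix`).

Entanglement comes from the witness. In a separable decomposition of a symmetric state every product
vector that occurs has all its factors parallel, so strict positivity of `W` on the vectors `φ^{⊗N}`
forces a positive trace (`isEntangled_dickeOp_of_witness`). That positivity reduces to a polynomial
inequality in `w = |φ 0||φ 1| ∈ [0, 1/2]`, certified in the Bernstein basis. The trace is affine in
`p`, and its root is `p^W`. -/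

/-! ### Hamming weights and the Dicke isometry. -/

/-- The number of qubits in the state `1` in a computational basis vector. -/
def weight {N : ℕ} (x : Fin N → Fin 2) : ℕ := ∑ i, (x i : ℕ)

lemma fin_two_val_eq_ite (a : Fin 2) : (a : ℕ) = if a = 1 then 1 else 0 := by
  fin_cases a <;> rfl

lemma weight_eq_card {N : ℕ} (x : Fin N → Fin 2) :
    weight x = (Finset.univ.filter fun i => x i = 1).card := by
  simp only [weight, fin_two_val_eq_ite, Finset.sum_boole, Nat.cast_id]

lemma weight_le {N : ℕ} (x : Fin N → Fin 2) : weight x ≤ N := by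
  rw [weight_eq_card]
  simpa using Finset.card_filter_le (Finset.univ : Finset (Fin N)) fun i => x i = 1

lemma card_weight_eq (N m : ℕ) :
    (Finset.univ.filter fun x : Fin N → Fin 2 => weight x = m).card = N.choose m := by
  have h : (Finset.powersetCard m (Finset.univ : Finset (Fin N))).card = N.choose m := by simp
  rw [← h]
  refine Finset.card_nbij' (fun x => Finset.univ.filter fun i => x i = 1)
    (fun s i => if i ∈ s then 1 else 0) ?_ ?_ ?_ ?_
  · intro x hx
    simpa [Finset.mem_powersetCard, weight_eq_card] using hx
  · intro s hs
    simpa [Finset.mem_powersetCard, weight_eq_card] using hs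
  · intro x _
    funext i
    have : x i = 0 ∨ x i = 1 := by generalize x i = a; fin_cases a <;> simp
    rcases this with h | h <;> simp [h]
  · intro s _
    ext i
    simp

/-- The isometry from `ℂ^(N+1)` onto the symmetric subspace given by the Dicke basis. -/
noncomputable def dickeMatrix (N : ℕ) : Matrix (Fin N → Fin 2) (Fin (N + 1)) ℂ :=
  Matrix.of fun x α => dicke N α x

lemma dicke_apply (N : ℕ) (α : Fin (N + 1)) (x : Fin N → Fin 2) :
    dicke N α x =
      if weight x = (α : ℕ) then (((Real.sqrt (N.choose α : ℝ))⁻¹ : ℝ) : ℂ) else 0 := rfl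

lemma star_dicke (N : ℕ) (α : Fin (N + 1)) : star (dicke N α) = dicke N α := by
  funext x
  simp only [Pi.star_apply, dicke_apply]
  split_ifs
  · exact Complex.conj_ofReal _
  · simp

lemma dickeOp_eq (N : ℕ) (M : Matrix (Fin (N + 1)) (Fin (N + 1)) ℂ) :
    dickeOp N M = dickeMatrix N * M * (dickeMatrix N)ᴴ := by
  ext x y
  simp only [dickeOp, ketBra, Matrix.sum_apply, Matrix.smul_apply, vecMulVec_apply, mul_apply,
    dickeMatrix, conjTranspose_apply, of_apply, Finset.sum_mul, smul_eq_mul, Pi.star_apply]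
  rw [Finset.sum_comm]
  refine Finset.sum_congr rfl fun β _ => Finset.sum_congr rfl fun α _ => ?_
  ring

lemma choose_fin_pos {N : ℕ} (α : Fin (N + 1)) : (0 : ℝ) < N.choose α := by
  exact_mod_cast Nat.choose_pos (Nat.lt_succ_iff.mp α.2)

/-- Different weights have disjoint supports, and `card_weight_eq` cancels the squared
normalization. Traces and products can hence be computed on `(N+1) × (N+1)` matrices. -/
lemma dickeMatrix_isometry (N : ℕ) : (dickeMatrix N)ᴴ * dickeMatrix N = 1 := by
  ext α β
  have h1 : ∀ x, star (dicke N α x) = dicke N α x := fun x => congrFun (star_dicke N α) x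
  simp only [mul_apply, conjTranspose_apply, dickeMatrix, of_apply, h1, one_apply]
  split_ifs with hαβ
  · subst hαβ
    have : ∀ x, dicke N α x * dicke N α x =
        if weight x = (α : ℕ) then (((N.choose α : ℝ)⁻¹ : ℝ) : ℂ) else 0 := by
      intro x
      rw [dicke_apply]
      split_ifs
      · rw [← Complex.ofReal_mul, ← mul_inv, Real.mul_self_sqrt (choose_fin_pos α).le]
      · simp
    simp only [this]
    rw [← Finset.sum_filter, Finset.sum_const, card_weight_eq, nsmul_eq_mul,
      ← Complex.ofReal_natCast, ← Complex.ofReal_mul, mul_inv_cancel₀ (choose_fin_pos α).ne',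
      Complex.ofReal_one]
  · refine Finset.sum_eq_zero fun x _ => ?_
    rw [dicke_apply, dicke_apply]
    split_ifs with h2 h3
    · exact absurd (Fin.ext (h2.symm.trans h3)) hαβ
    all_goals simp

lemma trace_dickeOp (N : ℕ) (M : Matrix (Fin (N + 1)) (Fin (N + 1)) ℂ) :
    (dickeOp N M).trace = M.trace := by
  rw [dickeOp_eq, trace_mul_comm, ← Matrix.mul_assoc, dickeMatrix_isometry, Matrix.one_mul]

lemma dickeOp_mul (N : ℕ) (M M' : Matrix (Fin (N + 1)) (Fin (N + 1)) ℂ) :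
    dickeOp N M * dickeOp N M' = dickeOp N (M * M') := by
  simp only [dickeOp_eq]
  calc _ = dickeMatrix N * M * ((dickeMatrix N)ᴴ * dickeMatrix N) * M' * (dickeMatrix N)ᴴ := by
        simp only [Matrix.mul_assoc]
    _ = _ := by rw [dickeMatrix_isometry]; simp only [Matrix.mul_assoc, Matrix.one_mul]

lemma conjTranspose_dickeOp (N : ℕ) (M : Matrix (Fin (N + 1)) (Fin (N + 1)) ℂ) :
    (dickeOp N M)ᴴ = dickeOp N Mᴴ := by
  simp only [dickeOp_eq, conjTranspose_mul, conjTranspose_conjTranspose, Matrix.mul_assoc]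

lemma symConj_dickeOp {N : ℕ} (u M : Matrix (Fin (N + 1)) (Fin (N + 1)) ℂ) :
    symConj u (dickeOp N M) = dickeOp N (u * M * uᴴ) := by
  rw [symConj, conjTranspose_dickeOp, dickeOp_mul, dickeOp_mul]

lemma posSemidef_dickeOp {N : ℕ} {M : Matrix (Fin (N + 1)) (Fin (N + 1)) ℂ}
    (hM : M.PosSemidef) : (dickeOp N M).PosSemidef := by
  rw [dickeOp_eq]
  exact hM.mul_mul_conjTranspose_same _

/-! ### Permutation invariance of operators on the symmetric subspace. -/

lemma weight_comp_perm {N : ℕ} (x : Fin N → Fin 2) (σ : Equiv.Perm (Fin N)) :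
    weight (x ∘ σ) = weight x :=
  Equiv.sum_comp σ fun i => (x i : ℕ)

lemma permOp_mulVec_apply {N : ℕ} (σ : Equiv.Perm (Fin N)) (ψ : Ket N) (x : Fin N → Fin 2) :
    (permOp σ *ᵥ ψ) x = ψ (x ∘ σ.symm) := by
  have h : ∀ y, (x = y ∘ σ) ↔ y = x ∘ σ.symm := fun y =>
    ⟨fun h => by rw [h]; funext i; simp, fun h => by rw [h]; funext i; simp⟩
  simp [mulVec, dotProduct, permOp, h]

lemma permOp_mul_apply {N : ℕ} {n : Type*} (σ : Equiv.Perm (Fin N))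
    (A : Matrix (Fin N → Fin 2) n ℂ) (x : Fin N → Fin 2) (j : n) :
    (permOp σ * A) x j = A (x ∘ σ.symm) j :=
  permOp_mulVec_apply σ (fun y => A y j) x

lemma conjTranspose_permOp {N : ℕ} (σ : Equiv.Perm (Fin N)) :
    (permOp σ)ᴴ = permOp σ.symm := by
  ext x y
  have h : (y = x ∘ σ) ↔ x = y ∘ σ.symm :=
    ⟨fun h => by rw [h]; funext i; simp, fun h => by rw [h]; funext i; simp⟩
  simp only [conjTranspose_apply, permOp, of_apply, h, apply_ite star, star_one, star_zero]

lemma permOp_mul_dickeMatrix {N : ℕ} (σ : Equiv.Perm (Fin N)) :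
    permOp σ * dickeMatrix N = dickeMatrix N := by
  ext x α
  rw [permOp_mul_apply]
  simp only [dickeMatrix, of_apply, dicke_apply, weight_comp_perm]

lemma permOp_mul_dickeOp {N : ℕ} (σ : Equiv.Perm (Fin N))
    (M : Matrix (Fin (N + 1)) (Fin (N + 1)) ℂ) : permOp σ * dickeOp N M = dickeOp N M := by
  rw [dickeOp_eq, ← Matrix.mul_assoc, ← Matrix.mul_assoc, permOp_mul_dickeMatrix]

lemma dickeOp_mul_permOp {N : ℕ} (τ : Equiv.Perm (Fin N))
    (M : Matrix (Fin (N + 1)) (Fin (N + 1)) ℂ) : dickeOp N M * permOp τ = dickeOp N M := by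
  rw [← conjTranspose_inj, conjTranspose_mul, conjTranspose_permOp, conjTranspose_dickeOp,
    permOp_mul_dickeOp]

lemma isSymmetricState_dickeOp {N : ℕ} {M : Matrix (Fin (N + 1)) (Fin (N + 1)) ℂ}
    (hM : M.PosSemidef) (htr : M.trace = 1) : IsSymmetricState (dickeOp N M) :=
  ⟨posSemidef_dickeOp hM, by rw [trace_dickeOp, htr], fun σ τ => by
    rw [permOp_mul_dickeOp, dickeOp_mul_permOp]⟩

/-! ### The GHZ mixture in Dicke coordinates. -/

/-- Coordinates of the GHZ state in the Dicke basis. -/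
noncomputable def ghzCoord (N : ℕ) (s : ℂ) : Fin (N + 1) → ℂ :=
  (((Real.sqrt 2)⁻¹ : ℝ) : ℂ) • (Pi.single 0 1 + s • Pi.single (Fin.last N) 1)

/-- The state `p ρ₀ + (1 - p) |c⟩⟨c|` in Dicke coordinates. -/
noncomputable def mixMatrix (N : ℕ) (p : ℝ) (c : Fin (N + 1) → ℂ) :
    Matrix (Fin (N + 1)) (Fin (N + 1)) ℂ :=
  ((p / (N + 1) : ℝ) : ℂ) • (1 : Matrix _ _ ℂ) + ((1 - p : ℝ) : ℂ) • vecMulVec c (star c)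

lemma dickeMatrix_mulVec_single (N : ℕ) (α : Fin (N + 1)) :
    dickeMatrix N *ᵥ Pi.single α 1 = dicke N α := by
  funext x
  simp [dickeMatrix]

lemma ghz_eq (N : ℕ) (s : ℂ) : ghz N s = dickeMatrix N *ᵥ ghzCoord N s := by
  rw [ghz, ghzCoord, mulVec_smul, mulVec_add, mulVec_smul, dickeMatrix_mulVec_single,
    dickeMatrix_mulVec_single]

lemma ketBra_dickeMatrix (N : ℕ) (c d : Fin (N + 1) → ℂ) :
    ketBra (dickeMatrix N *ᵥ c) (dickeMatrix N *ᵥ d) = dickeOp N (vecMulVec c (star d)) := by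
  rw [dickeOp_eq, ketBra, mul_vecMulVec, vecMulVec_mul, star_mulVec]

lemma maxMixed_eq (N : ℕ) : maxMixed N = dickeOp N (((N : ℂ) + 1)⁻¹ • 1) := by
  simp [maxMixed, dickeOp, Finset.smul_sum, one_apply, ite_smul]

lemma dickeOp_add (N : ℕ) (M M' : Matrix (Fin (N + 1)) (Fin (N + 1)) ℂ) :
    dickeOp N (M + M') = dickeOp N M + dickeOp N M' := by
  simp only [dickeOp_eq, Matrix.mul_add, Matrix.add_mul]

lemma dickeOp_smul (N : ℕ) (a : ℂ) (M : Matrix (Fin (N + 1)) (Fin (N + 1)) ℂ) :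
    dickeOp N (a • M) = a • dickeOp N M := by
  simp only [dickeOp_eq, Matrix.mul_smul, Matrix.smul_mul]

lemma rho_eq (N : ℕ) (s : ℂ) (p : ℝ) : rho N s p = dickeOp N (mixMatrix N p (ghzCoord N s)) := by
  rw [rho, mixMatrix, dickeOp_add, dickeOp_smul, dickeOp_smul, maxMixed_eq, dickeOp_smul, smul_smul,
    ghz_eq, ketBra_dickeMatrix]
  congr 2
  push_cast
  rw [div_eq_mul_inv]

lemma norm_ghzCoord {N : ℕ} (hN : 0 < N) {s : ℂ} (hs : s = 1 ∨ s = -1) :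
    star (ghzCoord N s) ⬝ᵥ ghzCoord N s = 1 := by
  have h0 : (0 : Fin (N + 1)) ≠ Fin.last N := by
    intro h; simp [Fin.ext_iff] at h; omega
  have hs2 : star s * s = 1 := by rcases hs with rfl | rfl <;> simp
  have h2 : (((Real.sqrt 2)⁻¹ : ℝ) : ℂ) * (((Real.sqrt 2)⁻¹ : ℝ) : ℂ) = 1 / 2 := by
    rw [← Complex.ofReal_mul, ← mul_inv, Real.mul_self_sqrt (by norm_num)]; simp
  have hstar : star (((Real.sqrt 2)⁻¹ : ℝ) : ℂ) = (((Real.sqrt 2)⁻¹ : ℝ) : ℂ) :=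
    Complex.conj_ofReal _
  simp only [ghzCoord, star_smul, smul_dotProduct, dotProduct_smul, star_add, add_dotProduct,
    dotProduct_add, hstar, Pi.star_single]
  simp only [star_one, dotProduct_single, Pi.single_eq_same, smul_eq_mul,
    Pi.single_eq_of_ne h0, Pi.single_eq_of_ne h0.symm, mul_one, mul_zero, add_zero, zero_add]
  linear_combination (1 + star s * s) * h2 + (1 / 2) * hs2

lemma trace_mixMatrix {N : ℕ} {p : ℝ} {c : Fin (N + 1) → ℂ} (hc : star c ⬝ᵥ c = 1) :
    (mixMatrix N p c).trace = 1 := by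
  have h : ((N : ℂ) + 1) ≠ 0 := by exact_mod_cast Nat.succ_ne_zero N
  rw [mixMatrix, trace_add, trace_smul, trace_smul, trace_vecMulVec, dotProduct_comm, hc, trace_one]
  simp only [Fintype.card_fin, smul_eq_mul]
  push_cast
  field_simp
  ring

lemma posSemidef_mixMatrix {N : ℕ} {p : ℝ} (hp : p ∈ Set.Icc (0 : ℝ) 1) (c : Fin (N + 1) → ℂ) :
    (mixMatrix N p c).PosSemidef := by
  obtain ⟨h0, h1⟩ := hp
  refine (PosSemidef.one.smul ?_).add ((posSemidef_vecMulVec_self_star c).smul ?_)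
  · exact Complex.zero_le_real.mpr (by positivity)
  · exact Complex.zero_le_real.mpr (by linarith)

lemma isSymmetricState_rho {N : ℕ} (hN : 0 < N) {s : ℂ} (hs : s = 1 ∨ s = -1) {p : ℝ}
    (hp : p ∈ Set.Icc (0 : ℝ) 1) : IsSymmetricState (rho N s p) := by
  rw [rho_eq]
  exact isSymmetricState_dickeOp (posSemidef_mixMatrix hp _) (trace_mixMatrix (norm_ghzCoord hN hs))

/-- Unitary conjugation stays within the family of mixtures, so absolute properties reduce to
properties uniform in `c`. -/
lemma conj_mixMatrix {N : ℕ} {u : Matrix (Fin (N + 1)) (Fin (N + 1)) ℂ} (hu : u * uᴴ = 1) (p : ℝ)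
    (c : Fin (N + 1) → ℂ) : u * mixMatrix N p c * uᴴ = mixMatrix N p (u *ᵥ c) := by
  simp only [mixMatrix, Matrix.mul_add, Matrix.add_mul, Matrix.mul_smul, Matrix.smul_mul,
    Matrix.mul_one, hu, mul_vecMulVec, vecMulVec_mul, star_mulVec]

/-! ### Binomial identities behind the contraction expansion of the symmetric projector. -/

/-- Both sides equal the multinomial coefficient `(α+β+γ+δ)! / (α! β! γ! δ!)`: a set is split into
four classes by two binary attributes, taken in either order. -/
lemma choose_mul_choose_mul_choose {α β γ δ : ℕ} :
    (α + β + γ + δ).choose (β + γ) * (α + δ).choose α * (β + γ).choose β =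
      (α + β + γ + δ).choose (α + β) * (α + β).choose α * (γ + δ).choose δ := by
  have h1 : α + β + γ + δ = (β + γ) + (α + δ) := by ring
  have h2 : α + β + γ + δ = (α + β) + (γ + δ) := by ring
  have e1 := Nat.cast_add_choose ℚ (a := β + γ) (b := α + δ)
  have e2 := Nat.cast_add_choose ℚ (a := α + β) (b := γ + δ)
  rw [← h1] at e1
  rw [← h2] at e2
  have e3 := Nat.cast_add_choose ℚ (a := α) (b := δ)
  have e4 := Nat.cast_add_choose ℚ (a := β) (b := γ)
  have e5 := Nat.cast_add_choose ℚ (a := α) (b := β)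
  have e6 := Nat.cast_add_choose ℚ (a := δ) (b := γ)
  rw [add_comm δ γ] at e6
  have hf : ∀ n : ℕ, (n.factorial : ℚ) ≠ 0 := fun n => by exact_mod_cast n.factorial_ne_zero
  have := hf α; have := hf β; have := hf γ; have := hf δ
  have := hf (α + β); have := hf (β + γ); have := hf (α + δ); have := hf (γ + δ)
  have key : (((α + β + γ + δ).choose (β + γ) * (α + δ).choose α * (β + γ).choose β : ℕ) : ℚ) =
      ((α + β + γ + δ).choose (α + β) * (α + β).choose α * (γ + δ).choose δ : ℕ) := by
    push_cast
    rw [e1, e2, e3, e4, e5, e6]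
    field_simp
  exact_mod_cast key

/-- The two attributes are "contracted" (`h` qubits) and "in state 1" (`k` qubits). The `if` guards
the truncated subtraction `q - h - a`, which would otherwise give a spurious `choose _ 0 = 1`. -/
lemma choose_trinomial {q h a k : ℕ} (ha : a ≤ k) (hk : k ≤ q) (hh : h ≤ q) :
    q.choose h * (q - h).choose a * h.choose (k - a) =
      q.choose k * k.choose a * (if h + a ≤ q then (q - k).choose (q - h - a) else 0) := by
  split_ifs with h1
  · by_cases h2 : k - a ≤ h
    · have := @choose_mul_choose_mul_choose a (k - a) (h - (k - a)) (q - h - a)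
      rwa [show a + (k - a) + (h - (k - a)) + (q - h - a) = q by omega,
        show k - a + (h - (k - a)) = h by omega, show a + (q - h - a) = q - h by omega,
        show a + (k - a) = k by omega, show h - (k - a) + (q - h - a) = q - k by omega] at this
    · rw [Nat.choose_eq_zero_of_lt (show h < k - a by omega),
        Nat.choose_eq_zero_of_lt (show q - k < q - h - a by omega)]
      simp
  · rw [Nat.choose_eq_zero_of_lt (show q - h < a by omega)]
    simp

lemma choose_trinomial' {r h b u : ℕ} (hj : b + u ≤ r) (hh : h ≤ r) :
    r.choose h * (r - h).choose b * h.choose u =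
      r.choose (b + u) * (b + u).choose u *
        (if u ≤ h then (r - (b + u)).choose (h - u) else 0) := by
  have h0 := choose_trinomial (q := r) (h := h) (a := b) (k := b + u) (by omega) hj hh
  rw [show b + u - b = u by omega] at h0
  rw [h0, Nat.choose_symm_add]
  congr 1
  split_ifs with h1 h2 h2
  · rw [← Nat.choose_symm (show h - u ≤ r - (b + u) by omega)]
    congr 1
    omega
  · exact Nat.choose_eq_zero_of_lt (by omega)
  · exact (Nat.choose_eq_zero_of_lt (by omega)).symm
  · rfl

/-- Weight-basis coefficient of the contraction of `h` qubit pairs, one from each side. -/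
def contractionCoeff (h a b i j : ℕ) : ℕ :=
  if a ≤ i ∧ i + b = j + a then h.choose (i - a) else 0

/-- Vandermonde: the lower indices `q - h - a` and `h - (i - a)` add up to `q - i` for every `h`,
and the guards keep exactly the `h` for which both are genuine. -/
lemma sum_choose_shift {q r i j k a : ℕ} (hi : i ≤ q) (ha : a ≤ i) (hk : k ≤ q) (hak : a ≤ k) :
    ∑ h ∈ Finset.range (q + 1), (if h + a ≤ q then (q - k).choose (q - h - a) else 0) *
        (if i - a ≤ h then (r - j).choose (h - (i - a)) else 0) =
      (q - k + (r - j)).choose (q - i) := by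
  rw [Nat.add_choose_eq]
  simp only [← ite_and, ite_mul, mul_ite, zero_mul, mul_zero]
  rw [← Finset.sum_filter]
  refine Finset.sum_nbij' (fun h => (q - h - a, h - (i - a))) (fun x => q - a - x.1) ?_ ?_ ?_ ?_ ?_
  · intro h hh
    simp only [Finset.mem_filter, Finset.mem_range, Finset.HasAntidiagonal.mem_antidiagonal] at hh ⊢
    omega
  · rintro ⟨x, y⟩ hx
    simp only [Finset.mem_filter, Finset.mem_range, Finset.HasAntidiagonal.mem_antidiagonal] at hx ⊢
    omega
  · intro h hh
    simp only [Finset.mem_filter, Finset.mem_range] at hh ⊢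
    omega
  · rintro ⟨x, y⟩ hx
    simp only [Finset.HasAntidiagonal.mem_antidiagonal, Prod.mk.injEq] at hx ⊢
    omega
  · intro h hh
    rfl

/-- Entrywise form of the expansion of the partially transposed symmetric projector as a sum of
contractions of `h` pairs. It takes two Vandermonde sums: over `h` for fixed `a, b`, then over `a`,
with `b` determined by weight conservation. -/
lemma sum_contraction {q r i j k l : ℕ} (hi : i ≤ q) (hj : j ≤ r) (hk : k ≤ q) :
    ∑ h ∈ Finset.range (q + 1), ∑ a ∈ Finset.range (q + 1), ∑ b ∈ Finset.range (r + 1),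
        q.choose h * r.choose h * (q - h).choose a * (r - h).choose b *
          (contractionCoeff h a b i j * contractionCoeff h a b k l) =
      if k + j = i + l then
        q.choose k * r.choose j * (k + j).choose i * (q - k + (r - j)).choose (q - i) else 0 := by
  split_ifs with hm
  -- For fixed `a, b` the trinomial identities move all dependence on `h` into the two factors of
  -- `sum_choose_shift`.
  · have hterm : ∀ a ∈ Finset.range (q + 1), ∀ b ∈ Finset.range (r + 1),
        ∑ h ∈ Finset.range (q + 1), q.choose h * r.choose h * (q - h).choose a * (r - h).choose b *
          (contractionCoeff h a b i j * contractionCoeff h a b k l) =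
        if a ≤ i ∧ i + b = j + a then q.choose k * r.choose j * (k.choose a * j.choose (i - a)) *
          (q - k + (r - j)).choose (q - i) else 0 := by
      intro a _ b hb
      split_ifs with hab
      · obtain ⟨hai, hab'⟩ := hab
        by_cases hak : a ≤ k
        · rw [← sum_choose_shift (j := j) (r := r) hi hai hk hak, Finset.mul_sum]
          refine Finset.sum_congr rfl fun h hh => ?_
          have hh' : h ≤ q := Nat.lt_succ_iff.mp (Finset.mem_range.mp hh)
          rw [contractionCoeff, contractionCoeff, if_pos ⟨hai, hab'⟩, if_pos ⟨hak, by omega⟩]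
          have e1 := choose_trinomial hak hk hh'
          obtain ⟨u, rfl⟩ := Nat.exists_eq_add_of_le hai
          have hju : j = b + u := by omega
          subst hju
          rw [show a + u - a = u by omega]
          by_cases hr : h ≤ r
          · have e2 := choose_trinomial' hj hr
            calc _ = (q.choose h * (q - h).choose a * h.choose (k - a)) *
                  (r.choose h * (r - h).choose b * h.choose u) := by ring
              _ = _ := by rw [e1, e2]; ring
          · rw [Nat.choose_eq_zero_of_lt (show r < h by omega)]
            simp only [mul_zero, zero_mul]
            symm
            split_ifs with h1 h2
            · rw [Nat.choose_eq_zero_of_lt (show r - (b + u) < h - u by omega)]; simp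
            all_goals simp
        · rw [Nat.choose_eq_zero_of_lt (show k < a by omega)]
          simp [contractionCoeff, hak]
      · simp [contractionCoeff, hab]
    calc _ = ∑ a ∈ Finset.range (q + 1), ∑ b ∈ Finset.range (r + 1),
          if a ≤ i ∧ i + b = j + a then q.choose k * r.choose j * (k.choose a * j.choose (i - a)) *
            (q - k + (r - j)).choose (q - i) else 0 := by
          rw [Finset.sum_comm]
          refine Finset.sum_congr rfl fun a ha => ?_
          rw [Finset.sum_comm]
          exact Finset.sum_congr rfl fun b hb => hterm a ha b hb
      _ = ∑ a ∈ Finset.range (i + 1), q.choose k * r.choose j * (k.choose a * j.choose (i - a)) *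
            (q - k + (r - j)).choose (q - i) := by
          have hsub : Finset.range (i + 1) ⊆ Finset.range (q + 1) :=
            Finset.range_subset_range.mpr (by omega)
          rw [← Finset.sum_subset hsub]
          · refine Finset.sum_congr rfl fun a ha => ?_
            have ha' : a ≤ i := Nat.lt_succ_iff.mp (Finset.mem_range.mp ha)
            by_cases hja : i - a ≤ j
            · rw [Finset.sum_eq_single (j - (i - a))]
              · rw [if_pos ⟨ha', by omega⟩]
              · intro b _ hb
                rw [if_neg (by omega)]
              · intro hb
                simp only [Finset.mem_range, not_lt] at hb
                omega
            · rw [Nat.choose_eq_zero_of_lt (show j < i - a by omega)]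
              simp
          · intro a _ ha
            simp only [Finset.mem_range, not_lt] at ha
            exact Finset.sum_eq_zero fun b _ => if_neg (by omega)
      _ = _ := by
          rw [← Finset.sum_mul, ← Finset.mul_sum, Nat.add_choose_eq k j i,
            Finset.Nat.sum_antidiagonal_eq_sum_range_succ_mk]
  · refine Finset.sum_eq_zero fun h _ => Finset.sum_eq_zero fun a _ => Finset.sum_eq_zero
      fun b _ => ?_
    simp only [contractionCoeff]
    split_ifs with h1 h2
    · omega
    all_goals simp

/-! ### Lower bound for the partial transpose of a pure state. -/

/-- Lagrange's identity: the left side is `2(‖x‖²‖y‖² - |⟨x, y⟩|²)`. -/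
lemma sum_normSq_wedge_le {β : Type*} [Fintype β] (x y : β → ℂ) :
    ∑ p : β × β, ‖x p.1 * y p.2 - x p.2 * y p.1‖ ^ 2 ≤
      2 * ((∑ b, ‖x b‖ ^ 2) * ∑ b, ‖y b‖ ^ 2) := by
  have hc : ∀ z : ℂ, ((‖z‖ ^ 2 : ℝ) : ℂ) = z * star z := fun z => by
    rw [Complex.ofReal_pow]; exact (Complex.mul_conj' z).symm
  have key : ((∑ p : β × β, ‖x p.1 * y p.2 - x p.2 * y p.1‖ ^ 2 : ℝ) : ℂ) =
      ((2 * ((∑ b, ‖x b‖ ^ 2) * ∑ b, ‖y b‖ ^ 2) - 2 * ‖∑ b, x b * star (y b)‖ ^ 2 : ℝ) : ℂ) := by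
    simp only [Complex.ofReal_sum, Complex.ofReal_sub, Complex.ofReal_mul, hc, star_sum, star_mul',
      star_star, star_sub]
    rw [Finset.sum_mul_sum, Finset.sum_mul_sum, ← Fintype.sum_prod_type', ← Fintype.sum_prod_type']
    have hswap : ∀ f : β × β → ℂ, ∑ p, f p = ∑ p : β × β, f p.swap := fun f =>
      ((Equiv.prodComm β β).sum_comp f).symm
    have e : ∀ p : β × β, (x p.1 * y p.2 - x p.2 * y p.1) *
        (star (x p.1) * star (y p.2) - star (x p.2) * star (y p.1)) =
        (x p.1 * star (x p.1) * (y p.2 * star (y p.2)) -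
          x p.1 * star (y p.1) * (star (x p.2) * y p.2)) +
        (x p.2 * star (x p.2) * (y p.1 * star (y p.1)) -
          x p.2 * star (y p.2) * (star (x p.1) * y p.1)) := fun p => by ring
    simp only [e]
    rw [Finset.sum_add_distrib, hswap fun p => x p.2 * star (x p.2) * (y p.1 * star (y p.1)) -
          x p.2 * star (y p.2) * (star (x p.1) * y p.1)]
    simp only [Prod.fst_swap, Prod.snd_swap, Finset.sum_sub_distrib, Complex.ofReal_ofNat]
    ring
  have := Complex.ofReal_injective key
  rw [this]
  nlinarith [sq_nonneg ‖∑ b, x b * star (y b)‖]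

/-- Triangle inequality over `a`, the previous bound for each term, then Cauchy–Schwarz for the sum
of products of norms. -/
lemma sum_normSq_sum_wedge_le {α β : Type*} [Fintype α] [Fintype β] (x y : α → β → ℂ) :
    ∑ p : β × β, ‖∑ a, (x a p.1 * y a p.2 - x a p.2 * y a p.1)‖ ^ 2 ≤
      2 * ((∑ a, ∑ b, ‖x a b‖ ^ 2) * ∑ a, ∑ b, ‖y a b‖ ^ 2) := by
  set F : α → EuclideanSpace ℂ (β × β) :=
    fun a => WithLp.toLp 2 fun p => x a p.1 * y a p.2 - x a p.2 * y a p.1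
  have hF : ∀ a, ‖F a‖ ≤ Real.sqrt 2 * (Real.sqrt (∑ b, ‖x a b‖ ^ 2) *
      Real.sqrt (∑ b, ‖y a b‖ ^ 2)) := fun a => by
    rw [EuclideanSpace.norm_eq, ← Real.sqrt_mul (by positivity), ← Real.sqrt_mul (by norm_num)]
    exact Real.sqrt_le_sqrt (sum_normSq_wedge_le _ _)
  have h1 : ∑ p : β × β, ‖∑ a, (x a p.1 * y a p.2 - x a p.2 * y a p.1)‖ ^ 2 = ‖∑ a, F a‖ ^ 2 := by
    rw [EuclideanSpace.norm_sq_eq]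
    refine Finset.sum_congr rfl fun p _ => ?_
    rw [WithLp.ofLp_sum, Finset.sum_apply]
  have h2 : ‖∑ a, F a‖ ≤ Real.sqrt 2 * ∑ a, Real.sqrt (∑ b, ‖x a b‖ ^ 2) *
      Real.sqrt (∑ b, ‖y a b‖ ^ 2) := by
    rw [Finset.mul_sum]
    exact (norm_sum_le _ _).trans (Finset.sum_le_sum fun a _ => hF a)
  have h3 := Finset.sum_mul_sq_le_sq_mul_sq Finset.univ (fun a => Real.sqrt (∑ b, ‖x a b‖ ^ 2))
    fun a => Real.sqrt (∑ b, ‖y a b‖ ^ 2)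
  have hs : ∀ z : α → β → ℂ, ∀ a, Real.sqrt (∑ b, ‖z a b‖ ^ 2) ^ 2 = ∑ b, ‖z a b‖ ^ 2 :=
    fun z a => Real.sq_sqrt (by positivity)
  simp only [hs] at h3
  rw [h1]
  calc ‖∑ a, F a‖ ^ 2 ≤ (Real.sqrt 2 * ∑ a, Real.sqrt (∑ b, ‖x a b‖ ^ 2) *
        Real.sqrt (∑ b, ‖y a b‖ ^ 2)) ^ 2 := by gcongr
    _ = 2 * (∑ a, Real.sqrt (∑ b, ‖x a b‖ ^ 2) * Real.sqrt (∑ b, ‖y a b‖ ^ 2)) ^ 2 := by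
        rw [mul_pow, Real.sq_sqrt (by norm_num)]
    _ ≤ _ := by gcongr

/-- Polarization: `4 Re(z w̄) = |z + w|² - |z - w|²`. -/
lemma re_mul_star_ge (z w : ℂ) : -(‖z - w‖ ^ 2 / 4) ≤ (z * star w).re := by
  rw [Complex.sq_norm, Complex.normSq_apply]
  simp only [Complex.sub_re, Complex.sub_im, Complex.mul_re, Complex.star_def, Complex.conj_re,
    Complex.conj_im]
  nlinarith [sq_nonneg (z.re + w.re), sq_nonneg (z.im + w.im)]

/-- The partial transpose of `|ψ⟩⟨ψ|` is bounded below by `-‖ψ‖²/2`. -/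
lemma posSemidef_partialTranspose_pure_add {α β : Type*} [Fintype α] [Fintype β] [DecidableEq α]
    [DecidableEq β] (ψ : α → β → ℂ) :
    (Matrix.of (fun x y : α × β => ψ y.1 x.2 * star (ψ x.1 y.2)) +
      (((∑ a, ∑ b, ‖ψ a b‖ ^ 2) / 2 : ℝ) : ℂ) • (1 : Matrix (α × β) (α × β) ℂ)).PosSemidef := by
  set c : ℝ := ∑ a, ∑ b, ‖ψ a b‖ ^ 2 with hcdef
  have hH : (Matrix.of (fun x y : α × β => ψ y.1 x.2 * star (ψ x.1 y.2)) +
      ((c / 2 : ℝ) : ℂ) • (1 : Matrix (α × β) (α × β) ℂ)).IsHermitian := by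
    refine IsHermitian.add ?_ ?_
    · ext x y
      simp only [conjTranspose_apply, of_apply, star_mul', star_star]
      ring
    · exact IsSelfAdjoint.smul (Complex.conj_ofReal _) isHermitian_one
  refine PosSemidef.of_dotProduct_mulVec_nonneg hH fun χ => ?_
  rw [Complex.nonneg_iff]
  refine ⟨?_, (hH.im_star_dotProduct_mulVec_self χ).symm⟩
  set K : β → β → ℂ := fun b b' => ∑ a, star (χ (a, b)) * star (ψ a b') with hK
  -- The quadratic form is `∑ K b b' · conj (K b' b)`, so only the antisymmetric part of `K` can
  -- make it negative; that part is a sum of wedges.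
  have e1 : star χ ⬝ᵥ (Matrix.of (fun x y : α × β => ψ y.1 x.2 * star (ψ x.1 y.2)) *ᵥ χ) =
      ∑ p : β × β, K p.1 p.2 * star (K p.2 p.1) := by
    simp only [dotProduct, mulVec, of_apply, hK, star_sum, star_mul', star_star, Pi.star_apply,
      Finset.mul_sum, Finset.sum_mul, Fintype.sum_prod_type]
    rw [Finset.sum_comm]
    refine Finset.sum_congr rfl fun b _ => ?_
    rw [Finset.sum_comm_cycle]
    refine Finset.sum_congr rfl fun b' _ => ?_
    rw [Finset.sum_comm]
    refine Finset.sum_congr rfl fun a _ => Finset.sum_congr rfl fun a' _ => ?_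
    ring
  have e2 : star χ ⬝ᵥ χ = ((∑ a, ∑ b, ‖χ (a, b)‖ ^ 2 : ℝ) : ℂ) := by
    simp only [dotProduct, Fintype.sum_prod_type, Pi.star_apply, Complex.ofReal_sum,
      Complex.ofReal_pow]
    exact Finset.sum_congr rfl fun a _ => Finset.sum_congr rfl fun b _ => Complex.conj_mul' _
  have h1 := sum_normSq_sum_wedge_le (fun a b => star (χ (a, b))) fun a b => star (ψ a b)
  have h2 : ∑ p : β × β, -(‖K p.1 p.2 - K p.2 p.1‖ ^ 2 / 4) ≤
      ∑ p : β × β, (K p.1 p.2 * star (K p.2 p.1)).re :=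
    Finset.sum_le_sum fun p _ => re_mul_star_ge _ _
  simp only [norm_star, Finset.sum_sub_distrib] at h1
  rw [Finset.sum_neg_distrib, ← Finset.sum_div] at h2
  rw [add_mulVec, dotProduct_add, smul_mulVec, one_mulVec, dotProduct_smul, e1, e2, smul_eq_mul,
    ← Complex.ofReal_mul, Complex.add_re, Complex.ofReal_re, Complex.re_sum]
  simp only [hK] at h2 ⊢
  linarith

/-! ### The two operator bounds, on pairs of weights. -/

/-- Vandermonde again, now carrying a weight that depends only on `a + b`; it transfers the
normalization of a symmetric vector to its bipartite form. -/
lemma sum_choose_mul_choose (q r : ℕ) (g : ℕ → ℝ) :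
    ∑ a ∈ Finset.range (q + 1), ∑ b ∈ Finset.range (r + 1),
        (q.choose a * r.choose b : ℝ) * g (a + b) =
      ∑ m ∈ Finset.range (q + r + 1), ((q + r).choose m : ℝ) * g m := by
  have h : ∀ m, ((q + r).choose m : ℝ) =
      ∑ x ∈ (Finset.range (q + 1) ×ˢ Finset.range (r + 1)).filter (fun x => x.1 + x.2 = m),
        (q.choose x.1 * r.choose x.2 : ℝ) := by
    intro m
    rw [Nat.add_choose_eq]
    push_cast
    symm
    refine Finset.sum_subset ?_ ?_
    · intro x hx
      simp only [Finset.mem_filter] at hx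
      exact Finset.HasAntidiagonal.mem_antidiagonal.mpr hx.2
    · intro x hx hx'
      rw [Finset.HasAntidiagonal.mem_antidiagonal] at hx
      simp only [Finset.mem_filter, Finset.mem_product, Finset.mem_range, hx, and_true] at hx'
      by_cases h1 : x.1 < q + 1
      · rw [Nat.choose_eq_zero_of_lt (show r < x.2 by omega)]; simp
      · rw [Nat.choose_eq_zero_of_lt (show q < x.1 by omega)]; simp
  simp only [h, Finset.sum_mul]
  rw [← Finset.sum_product']
  rw [← Finset.sum_fiberwise_of_maps_to (t := Finset.range (q + r + 1)) (g := fun x => x.1 + x.2)]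
  · refine Finset.sum_congr rfl fun m _ => Finset.sum_congr rfl fun x hx => ?_
    rw [(Finset.mem_filter.mp hx).2]
  · intro x hx
    simp only [Finset.mem_product, Finset.mem_range] at hx ⊢
    omega

/-- Squared norms of the (unnormalized) basis dual to pairs of weights. -/
noncomputable def weightDiag (q r : ℕ) : 
    Matrix (Fin (q + 1) × Fin (r + 1)) (Fin (q + 1) × Fin (r + 1)) ℂ :=
  diagonal fun x => (((q.choose x.1 * r.choose x.2 : ℝ)⁻¹ : ℝ) : ℂ)

lemma posSemidef_weightDiag (q r : ℕ) : (weightDiag q r).PosSemidef := by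
  refine PosSemidef.diagonal fun x => ?_
  exact Complex.zero_le_real.mpr (by positivity)

/-- Rescaling by `√(C(q,a) C(r,b))` makes the pairs of weights an orthonormal product basis in which
`ψ` is a unit vector; undoing it turns the identity into `weightDiag`. -/
lemma posSemidef_pure_add_weightDiag {q r : ℕ} {f : ℕ → ℂ}
    (hf : ∑ m ∈ Finset.range (q + r + 1), ((q + r).choose m : ℝ) * ‖f m‖ ^ 2 = 1) :
    (Matrix.of (fun x y : Fin (q + 1) × Fin (r + 1) =>
        f (y.1 + x.2) * star (f (x.1 + y.2))) + ((1 / 2 : ℝ) : ℂ) • weightDiag q r).PosSemidef := by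
  have hsq : ∀ x : Fin (q + 1) × Fin (r + 1), (Real.sqrt (q.choose x.1) : ℂ) ≠ 0 ∧
      (Real.sqrt (r.choose x.2) : ℂ) ≠ 0 := fun x =>
    ⟨by exact_mod_cast (Real.sqrt_pos.mpr (choose_fin_pos x.1)).ne',
      by exact_mod_cast (Real.sqrt_pos.mpr (choose_fin_pos x.2)).ne'⟩
  set ψ : Fin (q + 1) → Fin (r + 1) → ℂ := fun a b =>
    ((Real.sqrt (q.choose a) : ℂ) * (Real.sqrt (r.choose b) : ℂ)) * f (a + b) with hψ
  have hnorm : ∑ a, ∑ b, ‖ψ a b‖ ^ 2 = 1 := by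
    rw [← hf, ← sum_choose_mul_choose, Finset.sum_range]
    refine Finset.sum_congr rfl fun a _ => ?_
    rw [Finset.sum_range]
    refine Finset.sum_congr rfl fun b _ => ?_
    simp only [hψ, norm_mul, mul_pow, Complex.norm_real, Real.norm_eq_abs, sq_abs]
    rw [Real.sq_sqrt (by positivity), Real.sq_sqrt (by positivity)]
  have hT := posSemidef_partialTranspose_pure_add ψ
  rw [hnorm] at hT
  set d : Fin (q + 1) × Fin (r + 1) → ℂ := fun x =>
    ((Real.sqrt (q.choose x.1) : ℂ) * (Real.sqrt (r.choose x.2) : ℂ))⁻¹ with hd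
  convert hT.mul_mul_conjTranspose_same (diagonal d) using 1
  have hstar : ∀ x, star (d x) = d x := fun x => by
    simp [hd, Complex.conj_ofReal]
  ext x y
  rw [diagonal_conjTranspose, mul_diagonal, diagonal_mul]
  simp only [Matrix.add_apply, Matrix.smul_apply, of_apply, weightDiag, diagonal_apply, one_apply, smul_eq_mul,
    Pi.star_apply, hstar]
  rw [mul_add, add_mul]
  congr 1
  · have hsc : star (ψ x.1 y.2) = ((Real.sqrt (q.choose x.1) : ℂ) * (Real.sqrt (r.choose y.2) : ℂ)) *
        star (f (x.1 + y.2)) := by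
      simp [hψ, Complex.conj_ofReal]
    rw [hsc]
    simp only [hψ, hd]
    have := (hsq x).1; have := (hsq x).2; have := (hsq y).1; have := (hsq y).2
    field_simp
  · split_ifs with hxy
    · subst hxy
      have e : d x * d x = (((q.choose x.1 * r.choose x.2 : ℝ)⁻¹ : ℝ) : ℂ) := by
        simp only [hd]
        rw [← mul_inv, ← Complex.ofReal_mul, ← Complex.ofReal_mul, ← Complex.ofReal_inv]
        congr 2
        nth_rewrite 3 [← Real.mul_self_sqrt (show (0 : ℝ) ≤ q.choose x.1 by positivity)]
        nth_rewrite 3 [← Real.mul_self_sqrt (show (0 : ℝ) ≤ r.choose x.2 by positivity)]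
        ring
      rw [← e]
      ring
    · simp

lemma contractionCoeff_zero (a b i j : ℕ) :
    contractionCoeff 0 a b i j = if a = i ∧ b = j then 1 else 0 := by
  rw [contractionCoeff]
  split_ifs with h1 h2 h2
  · rw [h2.1]; simp
  · exact Nat.choose_eq_zero_of_lt (by omega)
  · omega
  · rfl

/-- Trades the normalization `1 / C(q+r, m)` of the symmetric projector for `1 / C(q+r, q)`, with
the factors produced by `sum_contraction`. -/
lemma choose_mul_choose_eq {q r m i l : ℕ} (hi : i ≤ q) (hl : l ≤ r) (hm : m = i + l) :
    (q + r).choose q * q.choose i * r.choose l =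
      (q + r).choose m * (m.choose i * (q + r - m).choose (q - i)) := by
  subst hm
  have h := @choose_mul_choose_mul_choose i l (r - l) (q - i)
  rw [show i + l + (r - l) + (q - i) = q + r by omega, show l + (r - l) = r by omega,
    show i + (q - i) = q by omega, show r - l + (q - i) = q + r - (i + l) by omega] at h
  rw [show (q + r).choose q = (q + r).choose r from Nat.choose_symm_add]
  linarith

/-- The partial transpose of the projector onto the symmetric subspace, on pairs of weights, is
bounded below by the inverse of a binomial coefficient. -/
lemma posSemidef_symProj_sub_weightDiag (q r : ℕ) :
    (Matrix.of (fun x y : Fin (q + 1) × Fin (r + 1) =>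
        if (y.1 + x.2 : ℕ) = x.1 + y.2 then ((((q + r).choose (y.1 + x.2) : ℝ)⁻¹ : ℝ) : ℂ) else 0) -
      ((((q + r).choose q : ℝ)⁻¹ : ℝ) : ℂ) • weightDiag q r).PosSemidef := by
  set v : ℕ → ℕ → ℕ → Fin (q + 1) × Fin (r + 1) → ℂ := fun h a b x =>
    ((contractionCoeff h a b x.1 x.2 * (q.choose x.1 * r.choose x.2 : ℝ)⁻¹ : ℝ) : ℂ) with hv
  set w : ℕ → ℕ → ℕ → ℝ := fun h a b =>
    ((q.choose h * r.choose h * (q - h).choose a * (r - h).choose b : ℕ) : ℝ) with hw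
  -- The index is `h + 1` because the `h = 0` term is the multiple of `weightDiag` being subtracted;
  -- the rest is a nonnegative combination of rank-one projectors.
  have hS : (∑ h ∈ Finset.range q, ∑ a ∈ Finset.range (q + 1), ∑ b ∈ Finset.range (r + 1),
      ((w (h + 1) a b : ℝ) : ℂ) •
        vecMulVec (v (h + 1) a b) (star (v (h + 1) a b))).PosSemidef := by
    refine posSemidef_sum _ fun h _ => posSemidef_sum _ fun a _ => posSemidef_sum _ fun b _ => ?_
    exact (posSemidef_vecMulVec_self_star _).smul (Complex.zero_le_real.mpr (by positivity))
  convert hS.smul (Complex.zero_le_real.mpr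
    (inv_nonneg.mpr (Nat.cast_nonneg ((q + r).choose q)))) using 1
  ext x y
  obtain ⟨i, j⟩ := x
  obtain ⟨k, l⟩ := y
  have hi : (i : ℕ) ≤ q := Nat.lt_succ_iff.mp i.2
  have hj : (j : ℕ) ≤ r := Nat.lt_succ_iff.mp j.2
  have hk : (k : ℕ) ≤ q := Nat.lt_succ_iff.mp k.2
  have hl : (l : ℕ) ≤ r := Nat.lt_succ_iff.mp l.2
  have hsum := sum_contraction (l := l) hi hj hk
  rw [Finset.sum_range_succ'] at hsum
  have h0 : ∑ a ∈ Finset.range (q + 1), ∑ b ∈ Finset.range (r + 1),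
      q.choose 0 * r.choose 0 * (q - 0).choose a * (r - 0).choose b *
        (contractionCoeff 0 a b i j * contractionCoeff 0 a b k l) =
      if i = k ∧ j = l then q.choose i * r.choose j else 0 := by
    rw [Finset.sum_eq_single (i : ℕ), Finset.sum_eq_single (j : ℕ)]
    · simp [contractionCoeff_zero, Fin.ext_iff]
    · intro b _ hb; simp [contractionCoeff_zero, hb]
    · intro hb; exact absurd (Finset.mem_range.mpr j.2) hb
    · intro a _ ha; simp [contractionCoeff_zero, ha]
    · intro ha; exact absurd (Finset.mem_range.mpr i.2) ha
  rw [h0] at hsum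
  set T : ℕ := ∑ h ∈ Finset.range q, ∑ a ∈ Finset.range (q + 1), ∑ b ∈ Finset.range (r + 1),
      q.choose (h + 1) * r.choose (h + 1) * (q - (h + 1)).choose a * (r - (h + 1)).choose b *
        (contractionCoeff (h + 1) a b i j * contractionCoeff (h + 1) a b k l) with hT
  have hR : (∑ h ∈ Finset.range q, ∑ a ∈ Finset.range (q + 1), ∑ b ∈ Finset.range (r + 1),
      ((w (h + 1) a b : ℝ) : ℂ) • vecMulVec (v (h + 1) a b) (star (v (h + 1) a b))) (i, j) (k, l) =
      (((T : ℝ) * (q.choose i * r.choose j : ℝ)⁻¹ * (q.choose k * r.choose l : ℝ)⁻¹ : ℝ) : ℂ) := by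
    have hst : ∀ h a b x, star (v h a b x) = v h a b x := fun h a b x => Complex.conj_ofReal _
    simp only [Matrix.sum_apply, Matrix.smul_apply, vecMulVec_apply, Pi.star_apply, hst, smul_eq_mul]
    simp only [hv, ← Complex.ofReal_mul, ← Complex.ofReal_sum]
    congr 1
    rw [hT]
    simp only [Nat.cast_sum, Finset.sum_mul]
    refine Finset.sum_congr rfl fun h _ => Finset.sum_congr rfl fun a _ =>
      Finset.sum_congr rfl fun b _ => ?_
    simp only [hw]
    push_cast
    ring
  rw [Matrix.smul_apply, hR, Matrix.sub_apply, Matrix.smul_apply, of_apply, weightDiag, diagonal_apply]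
  have hci := (Nat.choose_pos hi).ne'
  have hcj := (Nat.choose_pos hj).ne'
  have hck := (Nat.choose_pos hk).ne'
  have hcl := (Nat.choose_pos hl).ne'
  have hcq := (Nat.choose_pos (show q ≤ q + r by omega)).ne'
  rw [← @Nat.cast_ne_zero ℝ] at hci hcj hck hcl hcq
  have hsumR : (T : ℝ) + (if i = k ∧ j = l then (q.choose i * r.choose j : ℝ) else 0) =
      if (k + j : ℕ) = i + l then (q.choose k * r.choose j *
        ((k + j : ℕ).choose i * (q - k + (r - j) : ℕ).choose (q - i)) : ℝ) else 0 := by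
    have := congrArg (Nat.cast : ℕ → ℝ) hsum
    push_cast at this
    rw [this]
    split_ifs <;> ring
  have hkey : (if (k + j : ℕ) = i + l then (((q + r).choose (k + j) : ℝ)⁻¹) else 0) -
      ((q + r).choose q : ℝ)⁻¹ *
        (if i = k ∧ j = l then (q.choose i * r.choose j : ℝ)⁻¹ else 0) =
      ((q + r).choose q : ℝ)⁻¹ *
        ((T : ℝ) * (q.choose i * r.choose j : ℝ)⁻¹ * (q.choose k * r.choose l : ℝ)⁻¹) := by
    rw [eq_sub_of_add_eq hsumR]
    have h1 : (if (k + j : ℕ) = i + l then (((q + r).choose (k + j) : ℝ)⁻¹) else 0) =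
        ((q + r).choose q : ℝ)⁻¹ * ((if (k + j : ℕ) = i + l then (q.choose k * r.choose j *
        ((k + j : ℕ).choose i * (q - k + (r - j) : ℕ).choose (q - i)) : ℝ) else 0) *
          (q.choose i * r.choose j : ℝ)⁻¹ * (q.choose k * r.choose l : ℝ)⁻¹) := by
      split_ifs with hm
      · have e := choose_mul_choose_eq hi hl hm
        rw [show q + r - (k + j) = q - k + (r - j) by omega] at e
        have eR := congrArg (Nat.cast : ℕ → ℝ) e
        push_cast at eR
        have hcm : ((q + r).choose (k + j) : ℝ) ≠ 0 := by
          exact_mod_cast (Nat.choose_pos (show (k + j : ℕ) ≤ q + r by omega)).ne'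
        field_simp
        linarith
      · simp
    have h2 : ((q + r).choose q : ℝ)⁻¹ *
        (if i = k ∧ j = l then (q.choose i * r.choose j : ℝ)⁻¹ else 0) = ((q + r).choose q : ℝ)⁻¹ *
        ((if i = k ∧ j = l then (q.choose i * r.choose j : ℝ) else 0) *
          (q.choose i * r.choose j : ℝ)⁻¹ * (q.choose k * r.choose l : ℝ)⁻¹) := by
      split_ifs with hm
      · obtain ⟨rfl, rfl⟩ := hm
        field_simp
      · simp
    rw [h1, h2]
    ring
  rw [smul_eq_mul, smul_eq_mul, ← Complex.ofReal_mul, ← hkey]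
  simp only [Prod.mk.injEq]
  split_ifs <;> push_cast <;> ring

/-! ### From pairs of weights to qubits: PPT and SAPPT. -/

/-- The number of qubits of `A` in the state `1`. -/
def weightOn {N : ℕ} (A : Finset (Fin N)) (x : Fin N → Fin 2) : ℕ := ∑ i ∈ A, (x i : ℕ)

lemma weightOn_le {N : ℕ} (A : Finset (Fin N)) (x : Fin N → Fin 2) : weightOn A x ≤ A.card := by
  simpa [weightOn] using Finset.sum_le_card_nsmul A (fun i => (x i : ℕ)) 1 fun i _ => Nat.lt_succ_iff.mp (x i).2

lemma weight_ite {N : ℕ} (A : Finset (Fin N)) (x y : Fin N → Fin 2) :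
    weight (fun i => if i ∈ A then x i else y i) = weightOn A x + weightOn Aᶜ y := by
  rw [weight, ← Finset.sum_add_sum_compl A, weightOn, weightOn]
  congr 1
  · exact Finset.sum_congr rfl fun i hi => by rw [if_pos hi]
  · exact Finset.sum_congr rfl fun i hi => by rw [if_neg (Finset.mem_compl.mp hi)]

/-- Value on weight-`m` basis vectors of the symmetric vector with Dicke coordinates `c`. -/
noncomputable def dickeValue {N : ℕ} (c : Fin (N + 1) → ℂ) (m : ℕ) : ℂ :=
  if h : m < N + 1 then c ⟨m, h⟩ * (((Real.sqrt (N.choose m : ℝ))⁻¹ : ℝ) : ℂ) else 0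

lemma dickeMatrix_mulVec_apply {N : ℕ} (c : Fin (N + 1) → ℂ) (x : Fin N → Fin 2) :
    (dickeMatrix N *ᵥ c) x = dickeValue c (weight x) := by
  have hx : weight x < N + 1 := Nat.lt_succ_iff.mpr (weight_le x)
  have h : ∀ α : Fin (N + 1), weight x = (α : ℕ) ↔ α = ⟨weight x, hx⟩ := fun α =>
    ⟨fun h => Fin.ext h.symm, fun h => by rw [h]⟩
  simp only [mulVec, dotProduct, dickeMatrix, of_apply, dicke_apply, h, ite_mul, zero_mul,
    Finset.sum_ite_eq', Finset.mem_univ, if_true, dickeValue, hx, dif_pos]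
  exact mul_comm _ _

lemma sum_choose_mul_dickeValue {N : ℕ} {c : Fin (N + 1) → ℂ} (hc : star c ⬝ᵥ c = 1) :
    ∑ m ∈ Finset.range (N + 1), (N.choose m : ℝ) * ‖dickeValue c m‖ ^ 2 = 1 := by
  rw [Finset.sum_range]
  have h : ∀ α : Fin (N + 1), (N.choose α : ℝ) * ‖dickeValue c α‖ ^ 2 = ‖c α‖ ^ 2 := by
    intro α
    have := choose_fin_pos α
    rw [dickeValue, dif_pos α.2, norm_mul, mul_pow, Complex.norm_real, Real.norm_eq_abs, sq_abs,
      inv_pow, Real.sq_sqrt this.le]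
    field_simp
  simp only [h]
  apply Complex.ofReal_injective
  rw [Complex.ofReal_one, ← hc, dotProduct, Complex.ofReal_sum]
  refine Finset.sum_congr rfl fun α _ => ?_
  rw [Complex.ofReal_pow]
  exact (Complex.conj_mul' _).symm

lemma dickeOp_one_apply (N : ℕ) (x y : Fin N → Fin 2) :
    dickeOp N 1 x y =
      if weight x = weight y then (((N.choose (weight x) : ℝ)⁻¹ : ℝ) : ℂ) else 0 := by
  have hy : weight y < N + 1 := Nat.lt_succ_iff.mpr (weight_le y)
  have h1 : (dickeOp N 1) x y = (dickeMatrix N *ᵥ fun α => dicke N α y) x := by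
    rw [dickeOp_eq, Matrix.mul_one, mul_apply]
    refine Finset.sum_congr rfl fun α _ => ?_
    congr 1
    exact congrFun (star_dicke N α) y
  rw [h1, dickeMatrix_mulVec_apply, dickeValue, dif_pos (Nat.lt_succ_iff.mpr (weight_le x)),
    dicke_apply]
  simp only [eq_comm (a := weight y)]
  split_ifs with h
  · rw [← Complex.ofReal_mul, ← mul_inv, Real.mul_self_sqrt (Nat.cast_nonneg _)]
  · simp

lemma dickeOp_mixMatrix_apply (N : ℕ) (p : ℝ) (c : Fin (N + 1) → ℂ) (x y : Fin N → Fin 2) :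
    dickeOp N (mixMatrix N p c) x y =
      ((p / (N + 1) : ℝ) : ℂ) *
        (if weight x = weight y then (((N.choose (weight x) : ℝ)⁻¹ : ℝ) : ℂ) else 0) +
      ((1 - p : ℝ) : ℂ) * (dickeValue c (weight x) * star (dickeValue c (weight y))) := by
  rw [mixMatrix, dickeOp_add, dickeOp_smul, dickeOp_smul, ← ketBra_dickeMatrix, Matrix.add_apply,
    Matrix.smul_apply, Matrix.smul_apply, dickeOp_one_apply, ketBra, vecMulVec_apply,
    Pi.star_apply, dickeMatrix_mulVec_apply, dickeMatrix_mulVec_apply, smul_eq_mul, smul_eq_mul]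

/-- Enough of the maximally mixed symmetric state makes its mixture with any pure symmetric state
PPT. -/
theorem isPPT_dickeOp_mixMatrix {N : ℕ} {p : ℝ} (hp1 : p ≤ 1)
    (hp : (1 - p) / 2 * N.choose (N / 2) ≤ p / (N + 1)) {c : Fin (N + 1) → ℂ}
    (hc : star c ⬝ᵥ c = 1) : IsPPT (dickeOp N (mixMatrix N p c)) := by
  intro A
  have hqr : A.card + Aᶜ.card = N := by rw [Finset.card_add_card_compl, Fintype.card_fin]
  set q := A.card with hq
  set r := Aᶜ.card with hr
  set e : (Fin N → Fin 2) → Fin (q + 1) × Fin (r + 1) := fun x =>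
    (⟨weightOn A x, Nat.lt_succ_iff.mpr (weightOn_le A x)⟩,
      ⟨weightOn Aᶜ x, Nat.lt_succ_iff.mpr (weightOn_le Aᶜ x)⟩) with he
  have h1 := posSemidef_symProj_sub_weightDiag q r
  have hf := sum_choose_mul_dickeValue hc
  have h2 := posSemidef_pure_add_weightDiag (q := q) (r := r) (f := dickeValue c)
    (by rw [hqr]; exact hf)
  rw [hqr] at h1
  have hCpos : (0 : ℝ) < N.choose q := by exact_mod_cast Nat.choose_pos (by omega)
  have hC : (N.choose q : ℝ) ≤ N.choose (N / 2) := by exact_mod_cast Nat.choose_le_middle q N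
  have hle : (1 - p) / 2 * N.choose q ≤ p / (N + 1) :=
    (mul_le_mul_of_nonneg_left hC (by linarith)).trans hp
  have ht : 0 ≤ p / (N + 1) := le_trans (mul_nonneg (by linarith) hCpos.le) hle
  have hd : 0 ≤ p / (N + 1) * (N.choose q : ℝ)⁻¹ - (1 - p) / 2 := by
    rw [← div_eq_mul_inv, sub_nonneg, le_div_iff₀ hCpos]
    exact hle
  have hK := ((h1.smul (Complex.zero_le_real.mpr ht)).add
    (h2.smul (Complex.zero_le_real.mpr (sub_nonneg.mpr hp1)))).add
    ((posSemidef_weightDiag q r).smul (Complex.zero_le_real.mpr hd))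
  -- Entries of the partial transpose depend only on the weights inside and outside `A`, so it is a
  -- pullback along `e`. The three multiples of `weightDiag` in `hK` cancel.
  convert hK.submatrix e using 1
  ext x y
  simp only [partialTranspose, of_apply, dickeOp_mixMatrix_apply, weight_ite, submatrix_apply,
    Matrix.add_apply, Matrix.sub_apply, Matrix.smul_apply, smul_eq_mul, he]
  push_cast
  ring

theorem isSAPPT_rho {N : ℕ} (hN : 0 < N) {s : ℂ} (hs : s = 1 ∨ s = -1) {p : ℝ}
    (hp01 : p ∈ Set.Icc (0 : ℝ) 1)
    (hp : (1 - p) / 2 * N.choose (N / 2) ≤ p / (N + 1)) : IsSAPPT (rho N s p) := by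
  refine ⟨isSymmetricState_rho hN hs hp01, fun u hu => ?_⟩
  have hu' := (mem_specialUnitaryGroup_iff.mp hu).1
  have h1 : u * uᴴ = 1 := mem_unitaryGroup_iff.mp hu'
  have h2 : uᴴ * u = 1 := mem_unitaryGroup_iff'.mp hu'
  rw [rho_eq, symConj_dickeOp, conj_mixMatrix h1]
  refine isPPT_dickeOp_mixMatrix hp01.2 hp ?_
  rw [star_mulVec, ← dotProduct_mulVec, mulVec_mulVec, h2, one_mulVec, norm_ghzCoord hN hs]

/-- The identity is one of the allowed unitaries, and it acts as the symmetric projector, which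
fixes `rho N s p`. -/
lemma not_isSAS_of_isEntangled {N : ℕ} {s : ℂ} {p : ℝ} (h : IsEntangled (rho N s p)) :
    ¬ IsSAS (rho N s p) := fun hS => h <| by
  have := hS.2 1 (one_mem _)
  rwa [rho_eq, symConj_dickeOp, conjTranspose_one, Matrix.one_mul, Matrix.mul_one, ← rho_eq] at this

/-! ### Entanglement of symmetric states from positivity on symmetric product vectors. -/

lemma trace_ketBra_mul {N : ℕ} (ψ : Ket N) (W : Op N) :
    (ketBra ψ ψ * W).trace = expect W ψ := by
  rw [ketBra, vecMulVec_mul, trace_vecMulVec, dotProduct_comm, expect, dotProduct_mulVec]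

lemma trace_permOp_mul_ketBra {N : ℕ} (σ : Equiv.Perm (Fin N)) (ψ : Ket N) :
    (permOp σ * ketBra ψ ψ).trace = star ψ ⬝ᵥ (permOp σ *ᵥ ψ) := by
  rw [trace_mul_comm, trace_ketBra_mul, expect]

lemma permOp_mulVec_productKet {N : ℕ} (σ : Equiv.Perm (Fin N)) (φ : Fin N → Fin 2 → ℂ) :
    permOp σ *ᵥ productKet φ = productKet fun i => φ (σ i) := by
  funext x
  rw [permOp_mulVec_apply, productKet, productKet, ← Equiv.prod_comp σ]
  simp

lemma star_productKet_dotProduct {N : ℕ} (φ χ : Fin N → Fin 2 → ℂ) :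
    star (productKet φ) ⬝ᵥ productKet χ = ∏ i, star (φ i) ⬝ᵥ χ i := by
  simp only [dotProduct, Fintype.prod_sum, productKet, Pi.star_apply, star_prod,
    ← Finset.prod_mul_distrib]

/-- A swap measures the overlap of two factors. On a symmetric state its expectation is 1, the
largest value an overlap can take. -/
lemma trace_swap_mul_ketBra {N : ℕ} {φ : Fin N → Fin 2 → ℂ} (hφ : ∀ i, star (φ i) ⬝ᵥ φ i = 1)
    {a b : Fin N} (hab : a ≠ b) :
    (permOp (Equiv.swap a b) * ketBra (productKet φ) (productKet φ)).trace =
      ((‖star (φ a) ⬝ᵥ φ b‖ ^ 2 : ℝ) : ℂ) := by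
  rw [trace_permOp_mul_ketBra, permOp_mulVec_productKet, star_productKet_dotProduct,
    Fintype.prod_eq_mul a b hab, Equiv.swap_apply_left, Equiv.swap_apply_right, Complex.ofReal_pow,
    ← Complex.mul_conj', star_dotProduct (φ b)]
  · rfl
  · rintro i ⟨hia, hib⟩
    rw [Equiv.swap_apply_of_ne_of_ne hia hib, hφ]

lemma star_sub_smul_dotProduct {n : Type*} [Fintype n] {a b : n → ℂ} (ha : star a ⬝ᵥ a = 1)
    (hb : star b ⬝ᵥ b = 1) :
    star (b - (star a ⬝ᵥ b) • a) ⬝ᵥ (b - (star a ⬝ᵥ b) • a) =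
      ((1 - ‖star a ⬝ᵥ b‖ ^ 2 : ℝ) : ℂ) := by
  have h : star b ⬝ᵥ a = star (star a ⬝ᵥ b) := star_dotProduct b a
  have h2 : (‖star a ⬝ᵥ b‖ : ℂ) ^ 2 = (star a ⬝ᵥ b) * star (star a ⬝ᵥ b) :=
    (Complex.mul_conj' _).symm
  simp only [star_sub, star_smul, sub_dotProduct, dotProduct_sub, smul_dotProduct, dotProduct_smul,
    ha, hb, h, smul_eq_mul, Complex.ofReal_sub, Complex.ofReal_one, Complex.ofReal_pow, h2]
  ring

lemma normSq_star_dotProduct_le {n : Type*} [Fintype n] {a b : n → ℂ} (ha : star a ⬝ᵥ a = 1)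
    (hb : star b ⬝ᵥ b = 1) : ‖star a ⬝ᵥ b‖ ^ 2 ≤ 1 := by
  have h := dotProduct_star_self_nonneg (b - (star a ⬝ᵥ b) • a)
  rw [star_sub_smul_dotProduct ha hb, Complex.zero_le_real] at h
  linarith

lemma eq_smul_of_normSq_eq_one {n : Type*} [Fintype n] {a b : n → ℂ} (ha : star a ⬝ᵥ a = 1)
    (hb : star b ⬝ᵥ b = 1) (h : ‖star a ⬝ᵥ b‖ ^ 2 = 1) : b = (star a ⬝ᵥ b) • a := by
  have h0 := star_sub_smul_dotProduct ha hb
  rw [h, sub_self, Complex.ofReal_zero] at h0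
  exact sub_eq_zero.mp (dotProduct_star_self_eq_zero.mp h0)

lemma productKet_smul {N : ℕ} (c : Fin N → ℂ) (φ : Fin N → Fin 2 → ℂ) :
    (productKet fun i => c i • φ i) = (∏ i, c i) • productKet φ := by
  funext x
  simp [productKet, Finset.prod_mul_distrib]

lemma expect_smul {N : ℕ} (W : Op N) (c : ℂ) (ψ : Ket N) :
    expect W (c • ψ) = ((‖c‖ ^ 2 : ℝ) : ℂ) * expect W ψ := by
  rw [expect, star_smul, mulVec_smul, smul_dotProduct, dotProduct_smul, smul_eq_mul, smul_eq_mul,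
    ← mul_assoc, expect, Complex.ofReal_pow]
  congr 1
  exact Complex.conj_mul' c

/-- If all factors of a product vector overlap fully with the first one, the vector is a phase times
a product of copies of it, with the same expectation values. -/
lemma expect_productKet_of_overlap {N : ℕ} (hN : 0 < N) (W : Op N) {φ : Fin N → Fin 2 → ℂ}
    (hφ : ∀ i, star (φ i) ⬝ᵥ φ i = 1)
    (h : ∀ i, ‖star (φ ⟨0, hN⟩) ⬝ᵥ φ i‖ ^ 2 = 1) :
    expect W (productKet φ) = expect W (productKet fun _ => φ ⟨0, hN⟩) := by
  have e : φ = fun i => (star (φ ⟨0, hN⟩) ⬝ᵥ φ i) • φ ⟨0, hN⟩ := by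
    refine funext fun i => ?_
    exact eq_smul_of_normSq_eq_one (hφ _) (hφ i) (h i)
  have e2 : productKet φ = (∏ i, star (φ ⟨0, hN⟩) ⬝ᵥ φ i) • productKet fun _ => φ ⟨0, hN⟩ := by
    conv_lhs => rw [e]
    rw [productKet_smul (fun i => star (φ ⟨0, hN⟩) ⬝ᵥ φ i) fun _ => φ ⟨0, hN⟩]
  rw [e2, expect_smul, norm_prod, ← Finset.prod_pow, Finset.prod_congr rfl fun i _ => h i]
  simp

/-- An operator that is positive on symmetric product states detects entanglement of symmetric
states. -/
theorem isEntangled_dickeOp_of_witness {N : ℕ} (hN : 0 < N)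
    {M : Matrix (Fin (N + 1)) (Fin (N + 1)) ℂ} (htr : M.trace = 1) {W : Op N}
    (hW : ∀ φ : Fin 2 → ℂ, star φ ⬝ᵥ φ = 1 → 0 < (expect W (productKet fun _ => φ)).re)
    (h : (dickeOp N M * W).trace.re ≤ 0) : IsEntangled (dickeOp N M) := by
  intro hsep
  obtain ⟨ι, _, w, P, hw0, hw1, hP, hsum⟩ := mem_convexHull_iff_exists_fintype.mp hsep
  choose φ hφ hPφ using hP
  have hsmul : ∀ i, ∀ X : Op N, ((w i • X).trace).re = w i * X.trace.re := fun i X => by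
    rw [trace_smul, Complex.real_smul, Complex.re_ofReal_mul]
  have hover : ∀ i, 0 < w i → ∀ b, ‖star (φ i ⟨0, hN⟩) ⬝ᵥ φ i b‖ ^ 2 = 1 := by
    intro i hi b
    by_cases hb : (⟨0, hN⟩ : Fin N) = b
    · subst hb; rw [hφ]; simp
    -- The state absorbs the swap, so the weighted mean of the overlaps is its trace, 1. As each
    -- overlap is at most 1, those with positive weight equal 1.
    have h1 : ∑ j, w j * ‖star (φ j ⟨0, hN⟩) ⬝ᵥ φ j b‖ ^ 2 = 1 := by
      have := congrArg Complex.re (congrArg Matrix.trace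
        (permOp_mul_dickeOp (Equiv.swap ⟨0, hN⟩ b) M))
      rw [trace_dickeOp, htr, ← hsum, Finset.mul_sum, trace_sum, Complex.re_sum,
        Complex.one_re] at this
      rw [← this]
      refine Finset.sum_congr rfl fun j _ => ?_
      rw [Matrix.mul_smul, hsmul, hPφ, trace_swap_mul_ketBra (hφ j) hb, Complex.ofReal_re]
    have h2 : ∑ j, w j * (1 - ‖star (φ j ⟨0, hN⟩) ⬝ᵥ φ j b‖ ^ 2) = 0 := by
      simp only [mul_sub, mul_one, Finset.sum_sub_distrib, h1, hw1, sub_self]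
    have h3 := (Finset.sum_eq_zero_iff_of_nonneg fun j _ => mul_nonneg (hw0 j)
      (sub_nonneg.mpr (normSq_star_dotProduct_le (hφ j _) (hφ j b)))).mp h2 i (Finset.mem_univ i)
    rcases mul_eq_zero.mp h3 with h4 | h4
    · exact absurd h4 hi.ne'
    · linarith
  have hnn : ∀ i, 0 < w i → 0 < (P i * W).trace.re := by
    intro i hi
    rw [hPφ, trace_ketBra_mul, expect_productKet_of_overlap hN W (hφ i) (hover i hi)]
    exact hW _ (hφ i _)
  have htot : (dickeOp N M * W).trace.re = ∑ i, w i * (P i * W).trace.re := by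
    rw [← hsum, Finset.sum_mul, trace_sum, Complex.re_sum]
    exact Finset.sum_congr rfl fun i _ => by rw [Matrix.smul_mul, hsmul]
  have hpos : 0 < ∑ i, w i * (P i * W).trace.re := by
    obtain ⟨i, _, hi⟩ : ∃ i ∈ Finset.univ, 0 < w i := by
      by_contra hcon
      push Not at hcon
      have := Finset.sum_nonpos hcon
      linarith
    refine Finset.sum_pos' (fun j _ => ?_) ⟨i, Finset.mem_univ i, mul_pos hi (hnn i hi)⟩
    rcases (hw0 j).eq_or_lt with hj | hj
    · rw [← hj, zero_mul]
    · exact (mul_pos hj (hnn j hj)).le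
  linarith

/-! ### Expectation values and traces of corner witnesses. -/

lemma prod_apply_eq_pow {N : ℕ} (φ : Fin 2 → ℂ) (x : Fin N → Fin 2) :
    ∏ i, φ (x i) = φ 0 ^ (N - weight x) * φ 1 ^ weight x := by
  have h : ∀ i, φ (x i) = if x i = 1 then φ 1 else φ 0 := by
    intro i
    generalize x i = a
    fin_cases a <;> simp
  simp only [h]
  have hc := Finset.card_filter_add_card_filter_not (s := (Finset.univ : Finset (Fin N)))
    fun i => x i = 1
  rw [Finset.card_univ, Fintype.card_fin] at hc
  rw [Finset.prod_ite, Finset.prod_const, Finset.prod_const, weight_eq_card, mul_comm]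
  congr 2
  omega

lemma conjTranspose_dickeMatrix_mulVec_productKet {N : ℕ} (φ : Fin 2 → ℂ) (α : Fin (N + 1)) :
    ((dickeMatrix N)ᴴ *ᵥ productKet fun _ => φ) α =
      (Real.sqrt (N.choose α) : ℂ) * (φ 0 ^ (N - α : ℕ) * φ 1 ^ (α : ℕ)) := by
  have h1 : ∀ x, star (dicke N α x) = dicke N α x := fun x => congrFun (star_dicke N α) x
  have h2 : ∀ x : Fin N → Fin 2, dicke N α x * ∏ i, φ (x i) = if weight x = (α : ℕ) then
      (((Real.sqrt (N.choose α : ℝ))⁻¹ : ℝ) : ℂ) * (φ 0 ^ (N - α : ℕ) * φ 1 ^ (α : ℕ)) else 0 := by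
    intro x
    rw [dicke_apply, prod_apply_eq_pow]
    split_ifs with h
    · rw [h]
    · simp
  simp only [mulVec, dotProduct, conjTranspose_apply, dickeMatrix, of_apply, h1, productKet, h2]
  rw [← Finset.sum_filter, Finset.sum_const, card_weight_eq, nsmul_eq_mul, ← mul_assoc,
    ← Complex.ofReal_natCast, ← Complex.ofReal_mul]
  congr 2
  have := choose_fin_pos α
  nth_rewrite 1 [← Real.mul_self_sqrt this.le]
  rw [mul_assoc, mul_inv_cancel₀ (Real.sqrt_pos.mpr this).ne', mul_one]

lemma expect_dickeOp {N : ℕ} (M : Matrix (Fin (N + 1)) (Fin (N + 1)) ℂ) (ψ : Ket N) :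
    expect (dickeOp N M) ψ =
      star ((dickeMatrix N)ᴴ *ᵥ ψ) ⬝ᵥ (M *ᵥ ((dickeMatrix N)ᴴ *ᵥ ψ)) := by
  rw [expect, dickeOp_eq, star_mulVec, conjTranspose_conjTranspose, ← dotProduct_mulVec,
    mulVec_mulVec, mulVec_mulVec, Matrix.mul_assoc]

/-- A real diagonal in the Dicke basis together with two equal corner entries. -/
def cornerMatrix (N : ℕ) (d : Fin (N + 1) → ℝ) (c : ℝ) : Matrix (Fin (N + 1)) (Fin (N + 1)) ℂ :=
  diagonal (fun α => (d α : ℂ)) + ((c : ℂ) • Matrix.single 0 (Fin.last N) 1 +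
    (c : ℂ) • Matrix.single (Fin.last N) 0 1)

lemma star_dotProduct_cornerMatrix_mulVec {N : ℕ} (d : Fin (N + 1) → ℝ) (c : ℝ)
    (y : Fin (N + 1) → ℂ) :
    star y ⬝ᵥ (cornerMatrix N d c *ᵥ y) =
      ((∑ α, d α * ‖y α‖ ^ 2 + 2 * c * (star (y 0) * y (Fin.last N)).re : ℝ) : ℂ) := by
  have h1 : star y ⬝ᵥ (diagonal (fun α => (d α : ℂ)) *ᵥ y) =
      ((∑ α, d α * ‖y α‖ ^ 2 : ℝ) : ℂ) := by
    simp only [dotProduct, mulVec_diagonal, Complex.ofReal_sum, Complex.ofReal_mul,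
      Complex.ofReal_pow, Pi.star_apply]
    refine Finset.sum_congr rfl fun α _ => ?_
    rw [← Complex.conj_mul']
    simp only [Complex.star_def]
    ring
  have h2 : ((2 * (star (y 0) * y (Fin.last N)).re : ℝ) : ℂ) =
      star (y 0) * y (Fin.last N) + star (y (Fin.last N)) * y 0 := by
    rw [← Complex.add_conj]
    simp only [Complex.star_def, map_mul, Complex.conj_conj]
    ring
  rw [cornerMatrix, add_mulVec, add_mulVec, dotProduct_add, dotProduct_add, h1, smul_mulVec,
    smul_mulVec, dotProduct_smul, dotProduct_smul, Matrix.single_mulVec, Matrix.single_mulVec,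
    Complex.ofReal_add, mul_assoc, mul_left_comm, Complex.ofReal_mul, h2]
  simp [Function.update_apply, dotProduct]
  ring

lemma expect_cornerMatrix {N : ℕ} (d : Fin (N + 1) → ℝ) (c : ℝ) (φ : Fin 2 → ℂ) :
    ∃ R : ℝ, |R| ≤ (‖φ 0‖ * ‖φ 1‖) ^ N ∧
      expect (dickeOp N (cornerMatrix N d c)) (productKet fun _ => φ) =
      ((∑ α : Fin (N + 1), d α * (N.choose α * (‖φ 0‖ ^ (N - α : ℕ) * ‖φ 1‖ ^ (α : ℕ)) ^ 2) +
        2 * c * R : ℝ) : ℂ) := by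
  refine ⟨(star (φ 0 ^ N) * φ 1 ^ N).re, ?_, ?_⟩
  · refine (Complex.abs_re_le_norm _).trans ?_
    rw [norm_mul, norm_star, norm_pow, norm_pow, mul_pow]
  · rw [expect_dickeOp, star_dotProduct_cornerMatrix_mulVec]
    simp only [conjTranspose_dickeMatrix_mulVec_productKet]
    congr 2
    · refine Finset.sum_congr rfl fun α _ => ?_
      rw [norm_mul, mul_pow, Complex.norm_real, Real.norm_eq_abs, sq_abs,
        Real.sq_sqrt (Nat.cast_nonneg _), norm_mul, norm_pow, norm_pow]
    · simp

/-- The phases of `φ` enter only through the corner term, where the worst case is taken. What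
remains is an inequality in the moduli `u, v` of the two amplitudes. -/
lemma expect_cornerMatrix_pos {N : ℕ} {d : Fin (N + 1) → ℝ} {c : ℝ}
    (hpos : ∀ u v : ℝ, 0 ≤ u → 0 ≤ v → u ^ 2 + v ^ 2 = 1 →
      2 * |c| * (u * v) ^ N < ∑ α : Fin (N + 1), d α * (N.choose α * (u ^ (N - α : ℕ) * v ^ (α : ℕ)) ^ 2))
    {φ : Fin 2 → ℂ} (hφ : star φ ⬝ᵥ φ = 1) :
    0 < expect (dickeOp N (cornerMatrix N d c)) (productKet fun _ => φ) := by
  obtain ⟨R, hR, he⟩ := expect_cornerMatrix d c φ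
  have h1 : ‖φ 0‖ ^ 2 + ‖φ 1‖ ^ 2 = 1 := by
    apply Complex.ofReal_injective
    rw [Complex.ofReal_one, ← hφ, dotProduct, Fin.sum_univ_two, Complex.ofReal_add,
      Complex.ofReal_pow, Complex.ofReal_pow, ← Complex.conj_mul', ← Complex.conj_mul']
    rfl
  have h2 := hpos _ _ (norm_nonneg (φ 0)) (norm_nonneg (φ 1)) h1
  rw [he, Complex.zero_lt_real]
  have h3 : |c * R| ≤ |c| * (‖φ 0‖ * ‖φ 1‖) ^ N := by
    rw [abs_mul]
    gcongr
  have h4 := neg_abs_le (c * R)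
  linarith

/-- The sign in the corner meets the sign in the GHZ state, and `s² = 1` removes it. The maximally
mixed part contributes the mean of the diagonal. -/
lemma trace_rho_mul_cornerMatrix {N : ℕ} (hN : 0 < N) {s : ℝ} (hs : s = 1 ∨ s = -1) (p : ℝ)
    (d : Fin (N + 1) → ℝ) (κ : ℝ) :
    (rho N s p * dickeOp N (cornerMatrix N d (s * κ))).trace =
      ((p * ((∑ α, d α) / (N + 1)) + (1 - p) * ((d 0 + d (Fin.last N)) / 2 + κ) : ℝ) : ℂ) := by
  have h0 : (0 : Fin (N + 1)) ≠ Fin.last N := by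
    intro h; simp [Fin.ext_iff] at h; omega
  have hs2 : s * s = 1 := by rcases hs with rfl | rfl <;> norm_num
  have htr : (cornerMatrix N d (s * κ)).trace = ((∑ α, d α : ℝ) : ℂ) := by
    rw [cornerMatrix, trace_add, trace_add, trace_smul, trace_smul, trace_single_eq_of_ne _ _ _ h0,
      trace_single_eq_of_ne _ _ _ h0.symm, trace_diagonal]
    simp
  have hr : 2 * ((Real.sqrt 2)⁻¹ * (Real.sqrt 2)⁻¹) = 1 := by
    rw [← mul_inv, Real.mul_self_sqrt (by norm_num)]; norm_num
  have hg : ∀ α, ghzCoord N (s : ℂ) α = (((Real.sqrt 2)⁻¹ *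
      ((if α = 0 then 1 else 0) + s * (if α = Fin.last N then 1 else 0)) : ℝ) : ℂ) := by
    intro α
    simp only [ghzCoord, Pi.smul_apply, Pi.add_apply, Pi.single_apply, smul_eq_mul]
    split_ifs <;> push_cast <;> ring
  have hq : star (ghzCoord N (s : ℂ)) ⬝ᵥ (cornerMatrix N d (s * κ) *ᵥ ghzCoord N (s : ℂ)) =
      (((d 0 + d (Fin.last N)) / 2 + κ : ℝ) : ℂ) := by
    rw [star_dotProduct_cornerMatrix_mulVec]
    congr 1
    have hn : ∀ α, d α * ‖ghzCoord N (s : ℂ) α‖ ^ 2 = (if α = 0 then d 0 / 2 else 0) +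
        (if α = Fin.last N then d (Fin.last N) / 2 else 0) := by
      intro α
      rw [hg, Complex.norm_real, Real.norm_eq_abs, sq_abs]
      by_cases h1 : α = 0
      · subst h1
        simp only [h0, if_true, if_false]
        linear_combination d 0 / 2 * hr
      · by_cases h2 : α = Fin.last N
        · subst h2
          simp only [h1, if_true, if_false]
          linear_combination d (Fin.last N) / 2 * (s * s * hr + hs2)
        · simp [h1, h2]
    simp only [hn, Finset.sum_add_distrib, Finset.sum_ite_eq', Finset.mem_univ, if_true]
    rw [hg, hg, Complex.star_def, Complex.conj_ofReal, ← Complex.ofReal_mul, Complex.ofReal_re]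
    simp only [h0, h0.symm, if_true, if_false]
    linear_combination κ * (s * s * hr + hs2)
  rw [rho_eq, dickeOp_mul, trace_dickeOp, mixMatrix, Matrix.add_mul, Matrix.smul_mul,
    Matrix.smul_mul, Matrix.one_mul, trace_add, trace_smul, trace_smul, htr, vecMulVec_mul,
    trace_vecMulVec, dotProduct_comm, ← dotProduct_mulVec, hq]
  push_cast
  simp only [smul_eq_mul]
  ring

/-- Detection and absolute PPT for a corner witness, in terms of the numbers that define it. -/
theorem cornerWitness_detects {N : ℕ} (hN : 0 < N) {s : ℝ} (hs : s = 1 ∨ s = -1)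
    {d : Fin (N + 1) → ℝ} {κ t e lo hi pmin : ℝ}
    (hpos : ∀ u v : ℝ, 0 ≤ u → 0 ≤ v → u ^ 2 + v ^ 2 = 1 →
      2 * |κ| * (u * v) ^ N <
        ∑ α : Fin (N + 1), d α * (N.choose α * (u ^ (N - α : ℕ) * v ^ (α : ℕ)) ^ 2))
    (ht : (∑ α, d α) / (N + 1) = t) (he : (d 0 + d (Fin.last N)) / 2 + κ = e)
    (ht0 : 0 < t) (he0 : e < 0) (hlo : lo * (t - e) < -e) (hhi : -e < hi * (t - e))
    (hmin0 : 0 ≤ pmin) (hmin : (1 - pmin) / 2 * N.choose (N / 2) ≤ pmin / (N + 1)) :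
    (∀ φ : Fin 2 → ℂ, star φ ⬝ᵥ φ = 1 →
        0 ≤ expect (dickeOp N (cornerMatrix N d (s * κ))) (productKet fun _ => φ)) ∧
      ∃ pW : ℝ, lo < pW ∧ pW < hi ∧
        (∀ p ∈ Set.Icc (0 : ℝ) 1,
          ((rho N s p * dickeOp N (cornerMatrix N d (s * κ))).trace < 0 ↔ p < pW)) ∧
        (∀ p ∈ Set.Icc (0 : ℝ) pW, IsSymmetricState (rho N s p) ∧ IsEntangled (rho N s p)) ∧
        (∀ p ∈ Set.Icc pmin pW, IsSAPPT (rho N s p) ∧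
          IsEntangled (rho N s p) ∧ ¬ IsSAS (rho N s p)) := by
  have habs : |s * κ| = |κ| := by rcases hs with rfl | rfl <;> simp
  have hsC : (s : ℂ) = 1 ∨ (s : ℂ) = -1 := by rcases hs with rfl | rfl <;> simp
  rw [← habs] at hpos
  have hexp := fun φ (hφ : star φ ⬝ᵥ φ = 1) => expect_cornerMatrix_pos hpos hφ
  have hte : 0 < t - e := by linarith
  -- The trace is affine in `p`, running from `e < 0` at `p = 0` to `t > 0` at `p = 1`; its root `-e
  -- / (t - e)` is the threshold.
  have htrace : ∀ p : ℝ, (rho N s p * dickeOp N (cornerMatrix N d (s * κ))).trace =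
      ((p * (t - e) + e : ℝ) : ℂ) := by
    intro p
    rw [trace_rho_mul_cornerMatrix hN hs, ht, he]
    congr 1
    ring
  have hpW1 : -e / (t - e) < 1 := by rw [div_lt_one hte]; linarith
  -- At the closed endpoint the trace is 0, so nonnegativity of the witness would not suffice there;
  -- strict positivity on product vectors does.
  have hent : ∀ p ∈ Set.Icc (0 : ℝ) (-e / (t - e)), IsEntangled (rho N s p) := by
    intro p hp
    have hle := (le_div_iff₀ hte).mp hp.2
    have h1 := htrace p
    rw [rho_eq] at h1 ⊢
    refine isEntangled_dickeOp_of_witness hN (trace_mixMatrix (norm_ghzCoord hN hsC))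
      (fun φ hφ => (Complex.pos_iff.mp (hexp φ hφ)).1) ?_
    rw [h1, Complex.ofReal_re]
    linarith
  refine ⟨fun φ hφ => (hexp φ hφ).le, -e / (t - e), (lt_div_iff₀ hte).mpr hlo,
    (div_lt_iff₀ hte).mpr hhi, ?_, ?_, ?_⟩
  · intro p _
    rw [htrace, lt_div_iff₀ hte, ← Complex.ofReal_zero, Complex.real_lt_real]
    constructor <;> intro h <;> linarith
  · intro p hp
    exact ⟨isSymmetricState_rho hN hsC ⟨hp.1, hp.2.trans hpW1.le⟩, hent p hp⟩
  · intro p hp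
    have hp0 : 0 ≤ p := hmin0.trans hp.1
    have hE := hent p ⟨hp0, hp.2⟩
    refine ⟨isSAPPT_rho hN hsC ⟨hp0, hp.2.trans hpW1.le⟩ ?_, hE, not_isSAS_of_isEntangled hE⟩
    calc (1 - p) / 2 * N.choose (N / 2) ≤ (1 - pmin) / 2 * N.choose (N / 2) := by
          have := hp.1
          gcongr
      _ ≤ pmin / (N + 1) := hmin
      _ ≤ p / (N + 1) := by
          have := hp.1
          gcongr

/-! ### Positivity of the witness polynomials in `w = u v` on `[0, 1/2]`. -/

lemma witnessPoly_five_pos {w : ℝ} (h0 : 0 ≤ w) (h1 : w ≤ 1 / 2) :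
    2 * 9.31947 * w ^ 5 < 0.0366656 * (1 - 5 * w ^ 2 + 5 * w ^ 4) +
      -0.134595 * (5 * w ^ 2 * (1 - 3 * w ^ 2)) + 10 * w ^ 4 := by
  have key : ∀ x y : ℝ, 0 ≤ x → 0 ≤ y → ∀ k : ℕ, 0 ≤ x ^ k * y ^ (5 - k) := fun x y hx hy k => by
    positivity
  rcases le_total w (3 / 8) with h | h
  -- The products `x^k y^(5-k)` are, up to positive factors, the degree-5 Bernstein basis of the
  -- subinterval, and `linarith` finds a nonnegative combination. Subdividing sharpens such a
  -- certificate. Degrees 7 and 9 are treated alike.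
  · have hT := key (w - 0) (3 / 8 - w) (by linarith) (by linarith)
    have h0 := hT 0; have h1 := hT 1; have h2 := hT 2; have h3 := hT 3; have h4 := hT 4
    have h5 := hT 5
    norm_num at h0 h1 h2 h3 h4 h5
    linarith
  · have hT := key (w - 3 / 8) (1 / 2 - w) (by linarith) (by linarith)
    have h0 := hT 0; have h1 := hT 1; have h2 := hT 2; have h3 := hT 3; have h4 := hT 4
    have h5 := hT 5
    norm_num at h0 h1 h2 h3 h4 h5
    linarith

lemma witnessPoly_seven_pos {w : ℝ} (h0 : 0 ≤ w) (h1 : w ≤ 1 / 2) :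
    2 * 31.2405 * w ^ 7 < 0.00197514 * (1 - 7 * w ^ 2 + 14 * w ^ 4 - 7 * w ^ 6) +
      0.0643064 * (7 * w ^ 2 * (1 - 5 * w ^ 2 + 5 * w ^ 4)) +
      -0.189017 * (21 * w ^ 4 * (1 - 3 * w ^ 2)) + 35 * w ^ 6 := by
  have key : ∀ x y : ℝ, 0 ≤ x → 0 ≤ y → ∀ k : ℕ, 0 ≤ x ^ k * y ^ (7 - k) := fun x y hx hy k => by
    positivity
  rcases le_total w (9 / 20) with h | h
  · have hT := key (w - 0) (9 / 20 - w) (by linarith) (by linarith)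
    have h0 := hT 0; have h1 := hT 1; have h2 := hT 2; have h3 := hT 3; have h4 := hT 4
    have h5 := hT 5; have h6 := hT 6; have h7 := hT 7
    norm_num at h0 h1 h2 h3 h4 h5 h6 h7
    linarith
  · have hT := key (w - 9 / 20) (1 / 2 - w) (by linarith) (by linarith)
    have h0 := hT 0; have h1 := hT 1; have h2 := hT 2; have h3 := hT 3; have h4 := hT 4
    have h5 := hT 5; have h6 := hT 6; have h7 := hT 7
    norm_num at h0 h1 h2 h3 h4 h5 h6 h7
    linarith

lemma witnessPoly_nine_pos {w : ℝ} (h0 : 0 ≤ w) (h1 : w ≤ 1 / 2) :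
    2 * 114.305 * w ^ 9 < 0.00235791 * (1 - 9 * w ^ 2 + 27 * w ^ 4 - 30 * w ^ 6 + 9 * w ^ 8) +
      -0.013747 * (9 * w ^ 2 * (1 - 7 * w ^ 2 + 14 * w ^ 4 - 7 * w ^ 6)) +
      0.0621661 * (36 * w ^ 4 * (1 - 5 * w ^ 2 + 5 * w ^ 4)) +
      -0.1636915 * (84 * w ^ 6 * (1 - 3 * w ^ 2)) + 126 * w ^ 8 := by
  have key : ∀ x y : ℝ, 0 ≤ x → 0 ≤ y → ∀ k : ℕ, 0 ≤ x ^ k * y ^ (9 - k) := fun x y hx hy k => by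
    positivity
  rcases le_total w (9 / 40) with h | h
  · have hT := key (w - 0) (9 / 40 - w) (by linarith) (by linarith)
    have h0 := hT 0; have h1 := hT 1; have h2 := hT 2; have h3 := hT 3; have h4 := hT 4
    have h5 := hT 5; have h6 := hT 6; have h7 := hT 7; have h8 := hT 8; have h9 := hT 9
    norm_num at h0 h1 h2 h3 h4 h5 h6 h7 h8 h9
    linarith
  · have hT := key (w - 9 / 40) (1 / 2 - w) (by linarith) (by linarith)
    have h0 := hT 0; have h1 := hT 1; have h2 := hT 2; have h3 := hT 3; have h4 := hT 4
    have h5 := hT 5; have h6 := hT 6; have h7 := hT 7; have h8 := hT 8; have h9 := hT 9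
    norm_num at h0 h1 h2 h3 h4 h5 h6 h7 h8 h9
    linarith

/-! ### The three concrete witnesses. -/

lemma W5_eq (s : ℝ) : W5 s =
    dickeOp 5 (cornerMatrix 5 ![0.0366656, -0.134595, 1, 1, -0.134595, 0.0366656]
      (s * -9.31947)) := by
  rw [W5]
  congr 1
  ext i j
  fin_cases i <;> fin_cases j <;> simp [cornerMatrix, Fin.ext_iff]

lemma W7_eq (s : ℝ) : W7 s =
    dickeOp 7 (cornerMatrix 7 ![0.00197514, 0.0643064, -0.189017, 1, 1, -0.189017, 0.0643064,
      0.00197514] (s * -31.2405)) := by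
  rw [W7]
  congr 1
  ext i j
  fin_cases i <;> fin_cases j <;> simp [cornerMatrix, Fin.ext_iff]

lemma W9_eq (s : ℝ) : W9 s =
    dickeOp 9 (cornerMatrix 9 ![0.00235791, -0.013747, 0.0621661, -0.1636915, 1, 1, -0.1636915,
      0.0621661, -0.013747, 0.00235791] (s * -114.305)) := by
  rw [W9]
  congr 1
  ext i j
  fin_cases i <;> fin_cases j <;> simp [cornerMatrix, Fin.ext_iff]

lemma mul_le_half_of_sq_add_sq {u v : ℝ} (h : u ^ 2 + v ^ 2 = 1) : u * v ≤ 1 / 2 := by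
  nlinarith [sq_nonneg (u - v)]

/-- Newton's recursion for the power sums of `u²` and `v²`, whose sum is 1 and whose product is `(u
v)²`. -/
lemma pow_add_pow_succ_succ {u v : ℝ} (h : u ^ 2 + v ^ 2 = 1) (n : ℕ) :
    u ^ (2 * (n + 2)) + v ^ (2 * (n + 2)) =
      u ^ (2 * (n + 1)) + v ^ (2 * (n + 1)) - (u * v) ^ 2 * (u ^ (2 * n) + v ^ (2 * n)) := by
  linear_combination (u ^ (2 * (n + 1)) + v ^ (2 * (n + 1))) * h

/-- Even power sums of two numbers with `u² + v² = 1`, in terms of their product. -/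
lemma even_power_sums {u v : ℝ} (h : u ^ 2 + v ^ 2 = 1) :
    u ^ 6 + v ^ 6 = 1 - 3 * (u * v) ^ 2 ∧
    u ^ 10 + v ^ 10 = 1 - 5 * (u * v) ^ 2 + 5 * (u * v) ^ 4 ∧
    u ^ 14 + v ^ 14 = 1 - 7 * (u * v) ^ 2 + 14 * (u * v) ^ 4 - 7 * (u * v) ^ 6 ∧
    u ^ 18 + v ^ 18 =
      1 - 9 * (u * v) ^ 2 + 27 * (u * v) ^ 4 - 30 * (u * v) ^ 6 + 9 * (u * v) ^ 8 := by
  have h2 := pow_add_pow_succ_succ h 0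
  have h3 := pow_add_pow_succ_succ h 1
  have h4 := pow_add_pow_succ_succ h 2
  have h5 := pow_add_pow_succ_succ h 3
  have h6 := pow_add_pow_succ_succ h 4
  have h7 := pow_add_pow_succ_succ h 5
  have h8 := pow_add_pow_succ_succ h 6
  have h9 := pow_add_pow_succ_succ h 7
  norm_num only [mul_one, mul_zero, pow_zero] at h2 h3 h4 h5 h6 h7 h8 h9
  generalize u * v = w at *
  rw [h] at h2 h3
  rw [h2] at h3 h4
  rw [h3] at h4 h5
  rw [h4] at h5 h6
  rw [h5] at h6 h7
  rw [h6] at h7 h8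
  rw [h7] at h8 h9
  rw [h8] at h9
  refine ⟨?_, ?_, ?_, ?_⟩
  · rw [h3]; ring
  · rw [h5]; ring
  · rw [h7]; ring
  · rw [h9]; ring

lemma witness_five_pos {u v : ℝ} (hu : 0 ≤ u) (hv : 0 ≤ v) (h : u ^ 2 + v ^ 2 = 1) :
    2 * |(-9.31947 : ℝ)| * (u * v) ^ 5 <
      ∑ α : Fin 6, (![0.0366656, -0.134595, 1, 1, -0.134595, 0.0366656] : Fin 6 → ℝ) α *
        (Nat.choose 5 α * (u ^ (5 - α : ℕ) * v ^ (α : ℕ)) ^ 2) := by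
  have hw := witnessPoly_five_pos (mul_nonneg hu hv) (mul_le_half_of_sq_add_sq h)
  obtain ⟨e3, e5, -, -⟩ := even_power_sums h
  rw [← e3, ← e5] at hw
  -- The diagonal is symmetric, so the terms `α` and `5 - α` pair up into a power of `u v` times an
  -- even power sum.
  have e : ∑ α : Fin 6, (![0.0366656, -0.134595, 1, 1, -0.134595, 0.0366656] : Fin 6 → ℝ) α *
        (Nat.choose 5 α * (u ^ (5 - α : ℕ) * v ^ (α : ℕ)) ^ 2) =
      0.0366656 * (u ^ 10 + v ^ 10) + -0.134595 * (5 * (u * v) ^ 2 * (u ^ 6 + v ^ 6)) +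
        10 * (u * v) ^ 4 * (u ^ 2 + v ^ 2) := by
    simp [Fin.sum_univ_succ, Nat.choose]
    ring
  rw [e, h, abs_of_neg (by norm_num)]
  linarith

lemma witness_seven_pos {u v : ℝ} (hu : 0 ≤ u) (hv : 0 ≤ v) (h : u ^ 2 + v ^ 2 = 1) :
    2 * |(-31.2405 : ℝ)| * (u * v) ^ 7 <
      ∑ α : Fin 8, (![0.00197514, 0.0643064, -0.189017, 1, 1, -0.189017, 0.0643064,
        0.00197514] : Fin 8 → ℝ) α *
        (Nat.choose 7 α * (u ^ (7 - α : ℕ) * v ^ (α : ℕ)) ^ 2) := by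
  have hw := witnessPoly_seven_pos (mul_nonneg hu hv) (mul_le_half_of_sq_add_sq h)
  obtain ⟨e3, e5, e7, -⟩ := even_power_sums h
  rw [← e3, ← e5, ← e7] at hw
  have e : ∑ α : Fin 8, (![0.00197514, 0.0643064, -0.189017, 1, 1, -0.189017, 0.0643064,
        0.00197514] : Fin 8 → ℝ) α *
        (Nat.choose 7 α * (u ^ (7 - α : ℕ) * v ^ (α : ℕ)) ^ 2) =
      0.00197514 * (u ^ 14 + v ^ 14) + 0.0643064 * (7 * (u * v) ^ 2 * (u ^ 10 + v ^ 10)) +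
        -0.189017 * (21 * (u * v) ^ 4 * (u ^ 6 + v ^ 6)) +
        35 * (u * v) ^ 6 * (u ^ 2 + v ^ 2) := by
    simp [Fin.sum_univ_succ, Nat.choose]
    ring
  rw [e, h, abs_of_neg (by norm_num)]
  linarith

lemma witness_nine_pos {u v : ℝ} (hu : 0 ≤ u) (hv : 0 ≤ v) (h : u ^ 2 + v ^ 2 = 1) :
    2 * |(-114.305 : ℝ)| * (u * v) ^ 9 <
      ∑ α : Fin 10, (![0.00235791, -0.013747, 0.0621661, -0.1636915, 1, 1, -0.1636915,
        0.0621661, -0.013747, 0.00235791] : Fin 10 → ℝ) α *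
        (Nat.choose 9 α * (u ^ (9 - α : ℕ) * v ^ (α : ℕ)) ^ 2) := by
  have hw := witnessPoly_nine_pos (mul_nonneg hu hv) (mul_le_half_of_sq_add_sq h)
  obtain ⟨e3, e5, e7, e9⟩ := even_power_sums h
  rw [← e3, ← e5, ← e7, ← e9] at hw
  have e : ∑ α : Fin 10, (![0.00235791, -0.013747, 0.0621661, -0.1636915, 1, 1, -0.1636915,
        0.0621661, -0.013747, 0.00235791] : Fin 10 → ℝ) α *
        (Nat.choose 9 α * (u ^ (9 - α : ℕ) * v ^ (α : ℕ)) ^ 2) =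
      0.00235791 * (u ^ 18 + v ^ 18) + -0.013747 * (9 * (u * v) ^ 2 * (u ^ 14 + v ^ 14)) +
        0.0621661 * (36 * (u * v) ^ 4 * (u ^ 10 + v ^ 10)) +
        -0.1636915 * (84 * (u * v) ^ 6 * (u ^ 6 + v ^ 6)) +
        126 * (u * v) ^ 8 * (u ^ 2 + v ^ 2) := by
    simp [Fin.sum_univ_succ, Nat.choose]
    ring
  rw [e, h, abs_of_neg (by norm_num)]
  linarith

end SymQubit

theorem mainTheorem4 (s : ℂ) (hs : s = 1 ∨ s = -1) :
    -- five qubits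
    ((∀ φ : Fin 2 → ℂ, star φ ⬝ᵥ φ = 1 →
        0 ≤ SymQubit.expect (SymQubit.W5 s) (SymQubit.productKet fun _ => φ)) ∧
      ∃ pW : ℝ, 0.96862 < pW ∧ pW < 0.96863 ∧
        (∀ p ∈ Set.Icc (0 : ℝ) 1,
          ((SymQubit.rho 5 s p * SymQubit.W5 s).trace < 0 ↔ p < pW)) ∧
        (∀ p ∈ Set.Icc (0 : ℝ) pW, SymQubit.IsSymmetricState (SymQubit.rho 5 s p) ∧
          SymQubit.IsEntangled (SymQubit.rho 5 s p)) ∧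
        (∀ p ∈ Set.Icc (30 / 31 : ℝ) pW, SymQubit.IsSAPPT (SymQubit.rho 5 s p) ∧
          SymQubit.IsEntangled (SymQubit.rho 5 s p) ∧ ¬ SymQubit.IsSAS (SymQubit.rho 5 s p))) ∧
    -- seven qubits
    ((∀ φ : Fin 2 → ℂ, star φ ⬝ᵥ φ = 1 →
        0 ≤ SymQubit.expect (SymQubit.W7 s) (SymQubit.productKet fun _ => φ)) ∧
      ∃ pW : ℝ, 0.99302 < pW ∧ pW < 0.99303 ∧
        (∀ p ∈ Set.Icc (0 : ℝ) 1,
          ((SymQubit.rho 7 s p * SymQubit.W7 s).trace < 0 ↔ p < pW)) ∧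
        (∀ p ∈ Set.Icc (0 : ℝ) pW, SymQubit.IsSymmetricState (SymQubit.rho 7 s p) ∧
          SymQubit.IsEntangled (SymQubit.rho 7 s p)) ∧
        (∀ p ∈ Set.Icc (140 / 141 : ℝ) pW, SymQubit.IsSAPPT (SymQubit.rho 7 s p) ∧
          SymQubit.IsEntangled (SymQubit.rho 7 s p) ∧ ¬ SymQubit.IsSAS (SymQubit.rho 7 s p))) ∧
    -- nine qubits
    ((∀ φ : Fin 2 → ℂ, star φ ⬝ᵥ φ = 1 →
        0 ≤ SymQubit.expect (SymQubit.W9 s) (SymQubit.productKet fun _ => φ)) ∧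
      ∃ pW : ℝ, 0.99845 < pW ∧ pW < 0.99846 ∧
        (∀ p ∈ Set.Icc (0 : ℝ) 1,
          ((SymQubit.rho 9 s p * SymQubit.W9 s).trace < 0 ↔ p < pW)) ∧
        (∀ p ∈ Set.Icc (0 : ℝ) pW, SymQubit.IsSymmetricState (SymQubit.rho 9 s p) ∧
          SymQubit.IsEntangled (SymQubit.rho 9 s p)) ∧
        (∀ p ∈ Set.Icc (630 / 631 : ℝ) pW, SymQubit.IsSAPPT (SymQubit.rho 9 s p) ∧
          SymQubit.IsEntangled (SymQubit.rho 9 s p) ∧ ¬ SymQubit.IsSAS (SymQubit.rho 9 s p))) := by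
  -- `cornerMatrix` takes real entries, so the sign is first made real.
  obtain ⟨s, hs', rfl⟩ : ∃ s' : ℝ, (s' = 1 ∨ s' = -1) ∧ (s' : ℂ) = s := by
    rcases hs with rfl | rfl
    · exact ⟨1, Or.inl rfl, by simp⟩
    · exact ⟨-1, Or.inr rfl, by simp⟩
  rw [SymQubit.W5_eq, SymQubit.W7_eq, SymQubit.W9_eq]
  refine ⟨?_, ?_, ?_⟩
  -- `t` is the diagonal sum over `N + 1`, the value on the maximally mixed state; `e` is the corner
  -- diagonal entry plus the corner constant, the value on the GHZ state. The final goal `hmin`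
  -- holds with equality at `p_min`.
  · refine SymQubit.cornerWitness_detects (t := 1.8041412 / 6) (e := -9.2828044) (by norm_num) hs'
      (fun u v hu hv h => SymQubit.witness_five_pos hu hv h) ?_ ?_ ?_ ?_ ?_ ?_ ?_ ?_
    · simp [Fin.sum_univ_succ]; norm_num
    · simp [show Fin.last 5 = 5 from rfl]; norm_num
    all_goals norm_num [Nat.choose]
  · refine SymQubit.cornerWitness_detects (t := 1.75452908 / 8) (e := -31.23852486) (by norm_num) hs'
      (fun u v hu hv h => SymQubit.witness_seven_pos hu hv h) ?_ ?_ ?_ ?_ ?_ ?_ ?_ ?_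
    · simp [Fin.sum_univ_succ]; norm_num
    · simp [show Fin.last 7 = 7 from rfl]; norm_num
    all_goals norm_num [Nat.choose]
  · refine SymQubit.cornerWitness_detects (t := 1.77417102 / 10) (e := -114.30264209) (by norm_num) hs'
      (fun u v hu hv h => SymQubit.witness_nine_pos hu hv h) ?_ ?_ ?_ ?_ ?_ ?_ ?_ ?_
    · simp [Fin.sum_univ_succ]; norm_num
    · simp [show Fin.last 9 = 9 from rfl]; norm_num
    all_goals norm_num [Nat.choose]
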